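/- Call a complex number admissible if it is neither $0$ nor a negative integer. For admissible $c$ let $F(a,b;c;w)$ denote the Gauss hypergeometric function on $\mathbb{C}\setminus[1,\infty)$, i.e. the analytic continuation to this domain of the series $\sum_{k\ge 0}\frac{(a)_k(b)_k}{k!\,(c)_k}w^k$, $|w|<1$. **Theorem.** Let $a,b,c,z$ be complex numbers such that $z\notin(-\infty,0]$ and $a$, $c-a$, $b$, $c-b$ and $c$ are admissible. Then $$\frac{\Gamma(a)\Gamma(c-a)\Gamma(b)\Gamma(c-b)}{\Gamma(c)}\,F(a,b;c;1-z)=\frac{1}{2\pi i}\int_L\Gamma(a+s)\Gamma(b+s)\Gamma(c-a-b-s)\Gamma(-s)\,z^s\,ds,$$ where $z^s=e^{s\log z}$ with the principal branch of the logarithm, and $L$ is any path from $-i\infty$ to $i\infty$ that has the points $-a-n$ and $-b-n$ $(n=0,1,2,\dots)$ on its left and the points $n$ and $c-a-b+n$ $(n=0,1,2,\dots)$ on its right. Here a path from $-i\infty$ to $i\infty$ is a piecewise $C^1$ path $\gamma:\mathbb{R}\to\mathbb{C}$ with bounded real part and $\operatorname{Im}\gamma(t)\to\pm\infty$ as $t\to\pm\infty$;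 a point is on its left (right) if it can be joined in the complement of the path to all $-x$ (respectively $x$) with $x>0$ sufficiently large; and the integral is a convergent improper integral, the limit of $\int_{T_1}^{T_2}$ as $T_1\to-\infty$, $T_2\to\infty$ independently. Such paths $L$ exist, and $L$ can even be chosen without self-intersections. -/

import Mathlib

open Filter Topology MeasureTheory

/-- `ξ` is admissible if it is neither `0` nor a negative integer. -/
def Admissible (ξ : ℂ) : Prop := ∀ n : ℕ, ξ ≠ -(n : ℂ)

/-- `f` is an analytic function on `ℂ ∖ [1, ∞)` that is given on the unit disc by the Gauss series
`∑ (a)_k (b)_k / (k! (c)_k) w ^ k`. (`ℂ ∖ [1, ∞)` is the set of `w` with `1 - w ∉ (-∞, 0]`;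
it is connected, so two such functions agree on it.) -/
def IsGaussContinuation (a b c : ℂ) (f : ℂ → ℂ) : Prop :=
  DifferentiableOn ℂ f {w | 1 - w ∈ Complex.slitPlane} ∧
    ∀ w : ℂ, ‖w‖ < 1 → f w = ordinaryHypergeometric a b c w

/-- The Gauss hypergeometric function `F(a, b; c; ·)` on `ℂ ∖ [1, ∞)`: the analytic continuation
of the Gauss series. -/
noncomputable def gaussF (a b c : ℂ) : ℂ → ℂ := Classical.epsilon (IsGaussContinuation a b c)

/-- A path is piecewise `C¹` if there is a set of break points, finite in every bounded interval,
such that the path is `C¹` on every compact interval with no break point in its interior. -/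
def IsPiecewiseC1 (γ : ℝ → ℂ) : Prop :=
  Continuous γ ∧ ∃ S : Set ℝ, (∀ R : ℝ, (S ∩ Set.Icc (-R) R).Finite) ∧
    ∀ u v : ℝ, u < v → Disjoint (Set.Ioo u v) S → ContDiffOn ℝ 1 γ (Set.Icc u v)

/-- A piecewise `C¹` path from `-i∞` to `i∞` that stays in a vertical strip. -/
structure IsVerticalPath (γ : ℝ → ℂ) : Prop where
  piecewiseC1 : IsPiecewiseC1 γ
  bounded_re : ∃ B : ℝ, ∀ t, |(γ t).re| ≤ B
  tendsto_bot : Tendsto (fun t => (γ t).im) atBot atBot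
  tendsto_top : Tendsto (fun t => (γ t).im) atTop atTop

/-- `p` lies on the left of `γ`: it can be joined, without meeting `γ`, to the points `-x`,
`x` a large positive real. -/
def LiesLeft (γ : ℝ → ℂ) (p : ℂ) : Prop :=
  ∀ᶠ x : ℝ in atTop, JoinedIn (Set.range γ)ᶜ p (-(x : ℂ))

/-- `p` lies on the right of `γ`: it can be joined, without meeting `γ`, to the points `x`,
`x` a large positive real. -/
def LiesRight (γ : ℝ → ℂ) (p : ℂ) : Prop :=
  ∀ᶠ x : ℝ in atTop, JoinedIn (Set.range γ)ᶜ p (x : ℂ)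

/-- The path `γ` from `-i∞` to `i∞` has the poles of `Γ(a+s)Γ(b+s)` on its left and the poles of
`Γ(c-a-b-s)Γ(-s)` on its right. -/
structure IsBarnesContour (a b c : ℂ) (γ : ℝ → ℂ) : Prop where
  vertical : IsVerticalPath γ
  left_a : ∀ n : ℕ, LiesLeft γ (-a - n)
  left_b : ∀ n : ℕ, LiesLeft γ (-b - n)
  right_zero : ∀ n : ℕ, LiesRight γ n
  right_c : ∀ n : ℕ, LiesRight γ (c - a - b + n)

/-- The integral of `f` along `γ : ℝ → ℂ` converges, as an improper integral at both ends,
and has the value `J`. -/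
def HasContourIntegral (γ : ℝ → ℂ) (f : ℂ → ℂ) (J : ℂ) : Prop :=
  (∀ u v : ℝ, IntervalIntegrable (fun t => f (γ t) * deriv γ t) volume u v) ∧
    Tendsto (fun T : ℝ × ℝ => ∫ t in T.1..T.2, f (γ t) * deriv γ t) (atBot ×ˢ atTop) (𝓝 J)

/-! Put `e = c - a - b`, `d = 0` and let I(z) be the contour integral. Three facts give the theorem.

The integral depends only on how the path separates the poles. Each Gamma factor is O(exp(-(π/3)|Im
s|)) in vertical strips, as rotating the ray in Euler's integral by ±π/3 shows. The four factors
together therefore beat `z ^ s`, which is O(exp(π|Im s|)). A path may cross itself, so no winding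
numbers or residue theorem are used. In a strip containing the path, the principal parts at the
finitely many poles are subtracted. Pole terms of order at least 2 have a single-valued primitive. A
simple pole can be moved off the path's complement component only by crossing the path, so it is
moved to a fixed point outside the strip at no cost. What remains is holomorphic in the strip, where
it has a primitive with limits at both ends (`exists_forall_hasContourIntegral_of_meromorphic`).

Barnes' first lemma evaluates the integral at z = 1
(`SeparatesPoles.hasContourIntegral_barnesKernel`). For parameters with positive real part and the
imaginary axis as path, it follows from the Beta integral, Fubini and Mellin inversion. Translating
the path by 1 gives contiguous relations, which carry the formula to all admissible parameters.

Differentiation in z replaces `d` by `d + 1`, up to sign, because (d - s)Γ(d - s) = Γ(d + 1 - s).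
Hence all derivatives of I at z = 1 are values of Barnes' first lemma, and the Taylor series of I at
1 is a constant times the Gauss series in 1 - z. Since I is analytic on the slit plane, uniqueness
of analytic continuation identifies it everywhere. The differentiation is done on one path with
bounded speed and linearly growing imaginary part, constructed explicitly; path independence
transfers the result to every admissible path. -/

/-! ### Integrals along piecewise C¹ paths. -/

namespace IsPiecewiseC1

/-- Near every point, a piecewise `C¹` path is `C¹` on both sides of the point; if the point is not
a break point then the path is differentiable there. -/
theorem exists_sides {γ : ℝ → ℂ} {S : Set ℝ}
    (hS : ∀ R : ℝ, (S ∩ Set.Icc (-R) R).Finite)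
    (hγ : ∀ u v : ℝ, u < v → Disjoint (Set.Ioo u v) S → ContDiffOn ℝ 1 γ (Set.Icc u v)) (t : ℝ) :
    ∃ δ > 0, ContDiffOn ℝ 1 γ (Set.Icc (t - δ) t) ∧ ContDiffOn ℝ 1 γ (Set.Icc t (t + δ)) ∧
      (t ∉ S → ContDiffOn ℝ 1 γ (Set.Icc (t - δ) (t + δ))) := by
  have hfin : ((S ∩ Set.Icc (-(|t| + 1)) (|t| + 1)) \ {t}).Finite := (hS _).sdiff
  have hnhds : ((S ∩ Set.Icc (-(|t| + 1)) (|t| + 1)) \ {t})ᶜ ∈ 𝓝 t :=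
    hfin.isClosed.isOpen_compl.mem_nhds (by simp)
  obtain ⟨ε, hε, hball⟩ := Metric.mem_nhds_iff.1 hnhds
  have key : ∀ x ∈ S, |x - t| < min ε 1 → x = t := by
    intro x hxS hx
    by_contra hne
    have hx1 : x ∈ Metric.ball t ε := by
      rw [Metric.mem_ball, Real.dist_eq]; exact hx.trans_le (min_le_left _ _)
    refine hball hx1 ⟨⟨hxS, ?_⟩, hne⟩
    have h1 : |x - t| < 1 := hx.trans_le (min_le_right _ _)
    have := abs_lt.1 h1
    have h2 := neg_abs_le t
    have h3 := le_abs_self t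
    constructor <;> linarith
  have hδ : 0 < min ε 1 := lt_min hε one_pos
  refine ⟨min ε 1, hδ, hγ _ _ (by linarith) ?_, hγ _ _ (by linarith) ?_, fun ht =>
    hγ _ _ (by linarith) ?_⟩
  · refine Set.disjoint_left.2 fun x hx hxS => ?_
    have := key x hxS (abs_lt.2 ⟨by linarith [hx.1], by linarith [hx.2]⟩)
    exact hx.2.ne this
  · refine Set.disjoint_left.2 fun x hx hxS => ?_
    have := key x hxS (abs_lt.2 ⟨by linarith [hx.1], by linarith [hx.2]⟩)
    exact hx.1.ne' this
  · refine Set.disjoint_left.2 fun x hx hxS => ?_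
    have := key x hxS (abs_lt.2 ⟨by linarith [hx.1], by linarith [hx.2]⟩)
    exact ht (this ▸ hxS)

theorem integrableOn_deriv_Ioo {γ : ℝ → ℂ} {u v : ℝ} (huv : u < v)
    (h : ContDiffOn ℝ 1 γ (Set.Icc u v)) : IntegrableOn (deriv γ) (Set.Ioo u v) := by
  have h1 : ContinuousOn (derivWithin γ (Set.Icc u v)) (Set.Icc u v) :=
    h.continuousOn_derivWithin (uniqueDiffOn_Icc huv) le_rfl
  have h2 := (h1.integrableOn_compact (μ := volume) isCompact_Icc).mono_set Set.Ioo_subset_Icc_self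
  refine h2.congr_fun (fun x hx => ?_) measurableSet_Ioo
  exact derivWithin_of_mem_nhds (Icc_mem_nhds hx.1 hx.2)

theorem locallyIntegrable_deriv {γ : ℝ → ℂ} (hγ : IsPiecewiseC1 γ) :
    LocallyIntegrable (deriv γ) := by
  obtain ⟨-, S, hS, h⟩ := hγ
  intro t
  obtain ⟨δ, hδ, hl, hr, -⟩ := exists_sides hS h t
  refine ⟨Set.Ioo (t - δ) t ∪ {t} ∪ Set.Ioo t (t + δ), ?_, ?_⟩
  · refine mem_of_superset (Ioo_mem_nhds (a := t - δ) (b := t + δ) (by linarith) (by linarith)) ?_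
    intro x hx
    rcases lt_trichotomy x t with h | h | h
    · exact Or.inl (Or.inl ⟨hx.1, h⟩)
    · exact Or.inl (Or.inr h)
    · exact Or.inr ⟨h, hx.2⟩
  · exact ((integrableOn_deriv_Ioo (by linarith) hl).union (by simp)).union
      (integrableOn_deriv_Ioo (by linarith) hr)

theorem exists_countable_differentiableAt {γ : ℝ → ℂ} (hγ : IsPiecewiseC1 γ) :
    ∃ S : Set ℝ, S.Countable ∧ ∀ t ∉ S, DifferentiableAt ℝ γ t := by
  obtain ⟨-, S, hS, h⟩ := hγ
  refine ⟨S, ?_, fun t ht => ?_⟩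
  · have : S = ⋃ n : ℕ, S ∩ Set.Icc (-(n : ℝ)) n := by
      ext x
      simp only [Set.mem_iUnion, Set.mem_inter_iff, exists_and_left, iff_self_and]
      intro _
      obtain ⟨n, hn⟩ := exists_nat_ge |x|
      exact ⟨n, abs_le.1 hn⟩
    rw [this]
    exact Set.countable_iUnion fun n => (hS n).countable
  · obtain ⟨δ, hδ, -, -, hd⟩ := exists_sides hS h t
    exact ((hd ht).differentiableOn one_ne_zero).differentiableAt
      (Icc_mem_nhds (by linarith) (by linarith))

theorem intervalIntegrable_mul_deriv {γ : ℝ → ℂ} (hγ : IsPiecewiseC1 γ) {f : ℂ → ℂ}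
    (hf : Continuous fun t => f (γ t)) (u v : ℝ) :
    IntervalIntegrable (fun t => f (γ t) * deriv γ t) volume u v :=
  ((hγ.locallyIntegrable_deriv.integrableOn_isCompact
    isCompact_uIcc).intervalIntegrable).continuousOn_mul hf.continuousOn

/-- The fundamental theorem of calculus applies because the break points form a countable set. The
integral is then a difference of endpoint values, so the two limits may be taken independently. -/
theorem hasContourIntegral_of_primitive {γ : ℝ → ℂ} (hγ : IsPiecewiseC1 γ) {P f : ℂ → ℂ} {A B : ℂ}
    (hP : ∀ t, HasDerivAt P (f (γ t)) (γ t)) (hf : Continuous fun t => f (γ t))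
    (hbot : Tendsto (fun t => P (γ t)) atBot (𝓝 A))
    (htop : Tendsto (fun t => P (γ t)) atTop (𝓝 B)) :
    HasContourIntegral γ f (B - A) := by
  refine ⟨hγ.intervalIntegrable_mul_deriv hf, ?_⟩
  obtain ⟨S, hS, hd⟩ := hγ.exists_countable_differentiableAt
  have key : ∀ T : ℝ × ℝ, ∫ t in T.1..T.2, f (γ t) * deriv γ t = P (γ T.2) - P (γ T.1) := by
    intro T
    refine integral_eq_of_hasDerivAt_off_countable (fun t => P (γ t)) _ hS ?_ ?_
      (hγ.intervalIntegrable_mul_deriv hf _ _)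
    · exact continuousOn_of_forall_continuousAt fun t _ =>
        ((hP t).continuousAt.comp hγ.1.continuousAt :)
    · intro t ht
      have h1 := (hd t ht.2).hasDerivAt
      exact (hP t).comp t h1
  simp only [key]
  exact (htop.comp tendsto_snd).sub (hbot.comp tendsto_fst)

end IsPiecewiseC1

namespace HasContourIntegral

variable {γ : ℝ → ℂ} {f g : ℂ → ℂ} {J K : ℂ}

theorem add (hf : HasContourIntegral γ f J) (hg : HasContourIntegral γ g K) :
    HasContourIntegral γ (fun s => f s + g s) (J + K) := by
  have e : (fun t => (f (γ t) + g (γ t)) * deriv γ t) =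
      fun t => f (γ t) * deriv γ t + g (γ t) * deriv γ t := by
    ext t; ring
  refine ⟨fun u v => ?_, ?_⟩
  · rw [e]; exact (hf.1 u v).add (hg.1 u v)
  · rw [e]
    refine (hf.2.add hg.2).congr fun T => ?_
    exact (intervalIntegral.integral_add (hf.1 _ _) (hg.1 _ _)).symm

theorem const_mul (c : ℂ) (hf : HasContourIntegral γ f J) :
    HasContourIntegral γ (fun s => c * f s) (c * J) := by
  have e : (fun t => c * f (γ t) * deriv γ t) = fun t => c * (f (γ t) * deriv γ t) := by
    ext t; ring
  refine ⟨fun u v => ?_, ?_⟩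
  · rw [e]; exact (hf.1 u v).const_mul c
  · rw [e]
    refine (hf.2.const_mul c).congr fun T => ?_
    exact (intervalIntegral.integral_const_mul _ _).symm

theorem sub (hf : HasContourIntegral γ f J) (hg : HasContourIntegral γ g K) :
    HasContourIntegral γ (fun s => f s - g s) (J - K) := by
  simpa [sub_eq_add_neg] using hf.add (hg.const_mul (-1))

theorem congr (hf : HasContourIntegral γ f J) (h : ∀ t, f (γ t) = g (γ t)) :
    HasContourIntegral γ g J := by
  have e : (fun t => f (γ t) * deriv γ t) = fun t => g (γ t) * deriv γ t := by
    ext t; rw [h]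
  exact ⟨fun u v => e ▸ hf.1 u v, by rw [← e]; exact hf.2⟩

theorem unique (hf : HasContourIntegral γ f J) (hg : HasContourIntegral γ f K) : J = K :=
  tendsto_nhds_unique hf.2 hg.2

/-- The integral of a translate of the integrand is the integral along the translated path. -/
theorem of_add_const {c : ℂ} (hf : HasContourIntegral (fun t => γ t + c) f J) :
    HasContourIntegral γ (fun s => f (s + c)) J := by
  simpa only [HasContourIntegral, deriv_add_const] using hf

end HasContourIntegral

/-! ### Rational functions along vertical paths; moving a simple pole. -/

namespace IsVerticalPath

variable {γ : ℝ → ℂ}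

theorem tendsto_abs_im_cocompact (hγ : IsVerticalPath γ) :
    Tendsto (fun t => |(γ t).im|) (cocompact ℝ) atTop := by
  rw [cocompact_eq_atBot_atTop, tendsto_sup]
  exact ⟨tendsto_abs_atBot_atTop.comp hγ.tendsto_bot, tendsto_abs_atTop_atTop.comp hγ.tendsto_top⟩

theorem tendsto_cobounded (hγ : IsVerticalPath γ) :
    Tendsto γ (cocompact ℝ) (Bornology.cobounded ℂ) := by
  rw [← tendsto_norm_atTop_iff_cobounded]
  exact tendsto_atTop_mono (fun t => Complex.abs_im_le_norm _) hγ.tendsto_abs_im_cocompact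

theorem isClosed_range (hγ : IsVerticalPath γ) : IsClosed (Set.range γ) := by
  have h : IsProperMap γ := by
    refine isProperMap_iff_tendsto_cocompact.2 ⟨hγ.piecewiseC1.1, ?_⟩
    rw [← Metric.cobounded_eq_cocompact (α := ℂ)]
    exact hγ.tendsto_cobounded
  exact h.isClosedMap.isClosed_range

theorem tendsto_inv_sub (hγ : IsVerticalPath γ) (p : ℂ) :
    Tendsto (fun t => (γ t - p)⁻¹) (cocompact ℝ) (𝓝 0) := by
  refine tendsto_inv₀_cobounded.comp ?_
  exact (tendsto_sub_const_cobounded p).comp hγ.tendsto_cobounded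

theorem hasContourIntegral_of_tendsto_cocompact (hγ : IsVerticalPath γ) {P f : ℂ → ℂ} {A : ℂ}
    (hP : ∀ t, HasDerivAt P (f (γ t)) (γ t)) (hf : Continuous fun t => f (γ t))
    (h : Tendsto (fun t => P (γ t)) (cocompact ℝ) (𝓝 A)) : HasContourIntegral γ f 0 := by
  rw [← sub_self A]
  rw [cocompact_eq_atBot_atTop, tendsto_sup] at h
  exact hγ.piecewiseC1.hasContourIntegral_of_primitive hP hf h.1 h.2

theorem continuous_inv_sub (hγ : IsVerticalPath γ) {p : ℂ} (hp : p ∉ Set.range γ) :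
    Continuous fun t => (γ t - p)⁻¹ :=
  (hγ.piecewiseC1.1.sub continuous_const).inv₀ fun t ht => hp ⟨t, sub_eq_zero.1 ht⟩

/-- A pole of order at least 2 has a single-valued primitive that vanishes at both ends of the path,
so the side on which the pole lies is irrelevant. -/
theorem hasContourIntegral_inv_sub_pow (hγ : IsVerticalPath γ) {p : ℂ} (hp : p ∉ Set.range γ)
    (k : ℕ) : HasContourIntegral γ (fun s => ((s - p)⁻¹) ^ (k + 2)) 0 := by
  have hne : ∀ t, γ t - p ≠ 0 := fun t ht => hp ⟨t, sub_eq_zero.1 ht⟩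
  refine hγ.hasContourIntegral_of_tendsto_cocompact
    (P := fun s => -((k : ℂ) + 1)⁻¹ * ((s - p)⁻¹) ^ (k + 1)) (A := 0) (fun t => ?_) ?_ ?_
  · have h1 : HasDerivAt (fun s : ℂ => (s - p)⁻¹) (-1 / (γ t - p) ^ 2) (γ t) :=
      ((hasDerivAt_id (γ t)).sub_const p).inv (hne t)
    have h2 := (h1.pow (k + 1)).const_mul (-((k : ℂ) + 1)⁻¹)
    refine h2.congr_deriv ?_
    have : (k : ℂ) + 1 ≠ 0 := by exact_mod_cast k.succ_ne_zero
    have := hne t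
    push_cast
    field_simp
    simp only [pow_add]
    field_simp
  · exact (hγ.continuous_inv_sub hp).pow _
  · simpa using ((hγ.tendsto_inv_sub p).pow (k + 1)).const_mul (-((k : ℂ) + 1)⁻¹)

/-- The quotient (s - q)/(s - p) = 1 + (p - q)/(s - p) stays in the unit disc about 1 along the
path. Its principal logarithm is thus a primitive, and it tends to 0 at both ends. -/
theorem hasContourIntegral_inv_sub_of_near (hγ : IsVerticalPath γ) {p q : ℂ}
    (h : ∀ t, ‖p - q‖ < ‖γ t - p‖) :
    HasContourIntegral γ (fun s => (s - q)⁻¹ - (s - p)⁻¹) 0 := by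
  have hp : ∀ t, γ t - p ≠ 0 := fun t => norm_pos_iff.1 ((norm_nonneg _).trans_lt (h t))
  have hlt : ∀ t, ‖(p - q) * (γ t - p)⁻¹‖ < 1 := fun t => by
    rw [norm_mul, norm_inv, ← div_eq_mul_inv, div_lt_one (norm_pos_iff.2 (hp t))]
    exact h t
  have hslit : ∀ t, 1 + (p - q) * (γ t - p)⁻¹ ∈ Complex.slitPlane := fun t =>
    Complex.mem_slitPlane_of_norm_lt_one (hlt t)
  have hq : ∀ t, γ t - q ≠ 0 := fun t ht => by
    have := Complex.slitPlane_ne_zero (hslit t)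
    refine this ?_
    field_simp [hp t]
    linear_combination ht
  refine hγ.hasContourIntegral_of_tendsto_cocompact
    (P := fun s => Complex.log (1 + (p - q) * (s - p)⁻¹)) (A := 0) (fun t => ?_) ?_ ?_
  · have h1 : HasDerivAt (fun s : ℂ => (s - p)⁻¹) (-1 / (γ t - p) ^ 2) (γ t) :=
      ((hasDerivAt_id (γ t)).sub_const p).inv (hp t)
    refine (((h1.const_mul (p - q)).const_add 1).clog (hslit t)).congr_deriv ?_
    have e : 1 + (p - q) * (γ t - p)⁻¹ = (γ t - q) / (γ t - p) := by
      field_simp [hp t]; ring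
    rw [e]
    field_simp [hp t, hq t]
    ring
  · refine (hγ.continuous_inv_sub ?_).sub (hγ.continuous_inv_sub ?_)
    · rintro ⟨t, ht⟩; exact hq t (sub_eq_zero.2 ht)
    · rintro ⟨t, ht⟩; exact hp t (sub_eq_zero.2 ht)
  · have h1 : Tendsto (fun t => 1 + (p - q) * (γ t - p)⁻¹) (cocompact ℝ) (𝓝 1) := by
      simpa using ((hγ.tendsto_inv_sub p).const_mul (p - q)).const_add 1
    simpa using h1.clog Complex.one_mem_slitPlane

/-- Moving a simple pole without crossing the path does not change the integral. -/
theorem hasContourIntegral_inv_sub_of_joinedIn (hγ : IsVerticalPath γ) {p q : ℂ}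
    (h : JoinedIn (Set.range γ)ᶜ p q) :
    HasContourIntegral γ (fun s => (s - p)⁻¹ - (s - q)⁻¹) 0 := by
  obtain ⟨ω, hω⟩ := h
  have hpre : IsPreconnected (Set.range ω) := isPreconnected_range ω.continuous
  -- Vanishing of the integral is an equivalence relation between pole positions, and it holds
  -- locally by the previous case because the path is closed. Connectedness of the joining arc makes
  -- it hold between its ends.
  refine hpre.induction₂ (fun x y => HasContourIntegral γ (fun s => (s - x)⁻¹ - (s - y)⁻¹) 0)
    ?_ ?_ ?_ ⟨0, ω.source⟩ ⟨1, ω.target⟩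
  · rintro _ ⟨r, rfl⟩
    have hx := hγ.isClosed_range.isOpen_compl.mem_nhds (hω r)
    obtain ⟨ε, hε, hball⟩ := Metric.mem_nhds_iff.1 hx
    have : ∀ᶠ y in 𝓝[Set.range ω] (ω r), y ∈ Metric.ball (ω r) ε :=
      mem_nhdsWithin_of_mem_nhds (Metric.ball_mem_nhds _ hε)
    filter_upwards [this] with y hy
    have hnear := hγ.hasContourIntegral_inv_sub_of_near (p := ω r) (q := y) fun t => by
      rw [Metric.mem_ball, dist_comm, dist_eq_norm] at hy
      refine hy.trans_le (le_of_not_gt fun hlt => ?_)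
      exact hball (a := γ t) (by rwa [Metric.mem_ball, dist_eq_norm]) ⟨t, rfl⟩
    simpa using hnear.const_mul (-1)
  · intro x y z _ _ _ hxy hyz
    simpa using hxy.add hyz
  · intro x y _ _ hxy
    simpa using hxy.const_mul (-1)

theorem notMem_range_of_abs_re_lt {B : ℝ} (hB : ∀ t, |(γ t).re| < B) {p : ℂ} (hp : B ≤ |p.re|) :
    p ∉ Set.range γ := by
  rintro ⟨t, rfl⟩
  exact (hB t).not_ge hp

/-- The half-plane beyond the strip does not meet the path, so the far endpoint can be normalised.
It then depends on `B` only and serves all paths in the strip at once. -/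
theorem joinedIn_neg_of_liesLeft {B : ℝ} (hB : ∀ t, |(γ t).re| < B)
    {p : ℂ} (hp : LiesLeft γ p) : JoinedIn (Set.range γ)ᶜ p (-(B + 1 : ℝ) : ℂ) := by
  obtain ⟨x, hx, hxB⟩ := (hp.and (eventually_ge_atTop (B + 1))).exists
  refine hx.trans (JoinedIn.of_segment_subset ?_)
  refine ((convex_halfSpace_re_le (-B)).segment_subset ?_ ?_).trans ?_
  · simp only [Set.mem_ofPred_eq, Complex.neg_re, Complex.ofReal_re]; linarith
  · simp only [Set.mem_ofPred_eq, Complex.neg_re, Complex.ofReal_re]; linarith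
  · exact fun s hs => notMem_range_of_abs_re_lt hB (le_abs.2 (Or.inr (by simpa [le_neg] using hs)))

theorem joinedIn_of_liesRight {B : ℝ} (hB : ∀ t, |(γ t).re| < B)
    {p : ℂ} (hp : LiesRight γ p) : JoinedIn (Set.range γ)ᶜ p ((B + 1 : ℝ) : ℂ) := by
  obtain ⟨x, hx, hxB⟩ := (hp.and (eventually_ge_atTop (B + 1))).exists
  refine hx.trans (JoinedIn.of_segment_subset ?_)
  refine ((convex_halfSpace_re_ge B).segment_subset ?_ ?_).trans ?_
  · simp only [Set.mem_ofPred_eq, Complex.ofReal_re]; linarith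
  · simp only [Set.mem_ofPred_eq, Complex.ofReal_re]; linarith
  · exact fun s hs => notMem_range_of_abs_re_lt hB (le_abs.2 (Or.inl hs))

end IsVerticalPath

/-! ### Decay and primitives in vertical strips. -/

/-- The open vertical strip of half-width `B` around the imaginary axis. -/
def verticalStrip (B : ℝ) : Set ℂ := {s | |s.re| < B}

/-- The filter of points of a vertical strip whose imaginary part tends to `±∞`. -/
def stripEnds (B : ℝ) : Filter ℂ := comap (fun s : ℂ => |s.im|) atTop ⊓ 𝓟 (verticalStrip B)

theorem isOpen_verticalStrip (B : ℝ) : IsOpen (verticalStrip B) :=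
  isOpen_lt (Complex.continuous_re.abs) continuous_const

theorem convex_verticalStrip (B : ℝ) : Convex ℝ (verticalStrip B) := by
  have : verticalStrip B = Complex.reLm ⁻¹' Metric.ball 0 B := by
    ext s; simp [verticalStrip]
  rw [this]
  exact (convex_ball _ _).linear_preimage _

theorem eventually_stripEnds {B : ℝ} {p : ℂ → Prop} :
    (∀ᶠ s in stripEnds B, p s) ↔ ∃ M : ℝ, ∀ s : ℂ, |s.re| < B → M ≤ |s.im| → p s := by
  rw [stripEnds, eventually_inf_principal, eventually_comap, eventually_atTop]
  constructor
  · rintro ⟨M, hM⟩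
    exact ⟨M, fun s hs hs' => hM _ hs' s rfl hs⟩
  · rintro ⟨M, hM⟩
    exact ⟨M, fun b hb s hs hs' => hM s hs' (hs ▸ hb)⟩

theorem tendsto_neg_stripEnds (B : ℝ) :
    Tendsto (fun s : ℂ => -s) (stripEnds B) (stripEnds B) := by
  refine tendsto_inf.2 ⟨?_, ?_⟩
  · rw [tendsto_comap_iff]
    have : ((fun s : ℂ => |s.im|) ∘ fun s => -s) = fun s : ℂ => |s.im| := by
      ext s; simp
    rw [this]
    exact tendsto_comap.mono_left inf_le_left
  · rw [tendsto_principal]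
    exact eventually_stripEnds.2 ⟨0, fun s hs _ => by
      simpa [verticalStrip] using hs⟩

theorem inv_sub_isBigO_stripEnds (B : ℝ) (p : ℂ) :
    (fun s => (s - p)⁻¹) =O[stripEnds B] fun s => (s.im : ℝ)⁻¹ := by
  refine Asymptotics.IsBigO.of_bound 2 (eventually_stripEnds.2 ⟨2 * |p.im| + 1, fun s _ hs => ?_⟩)
  rw [norm_inv, norm_inv, Real.norm_eq_abs]
  have h1 : |s.im| - |p.im| ≤ ‖s - p‖ :=
    (abs_sub_abs_le_abs_sub _ _).trans (by simpa using Complex.abs_im_le_norm (s - p))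
  have h2 := abs_nonneg p.im
  have h3 : |s.im| / 2 ≤ ‖s - p‖ := by linarith
  have h4 : 0 < |s.im| := by linarith
  calc ‖s - p‖⁻¹ ≤ (|s.im| / 2)⁻¹ := inv_anti₀ (by linarith) h3
    _ = 2 * |s.im|⁻¹ := by rw [inv_div, div_eq_mul_inv]

theorem inv_sub_pow_isBigO_stripEnds (B : ℝ) (p : ℂ) (k : ℕ) :
    (fun s => ((s - p)⁻¹) ^ (k + 2)) =O[stripEnds B] fun s => (s.im ^ 2 : ℝ)⁻¹ := by
  refine ((inv_sub_isBigO_stripEnds B p).pow (k + 2)).trans ?_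
  refine Asymptotics.IsBigO.of_bound 1 (eventually_stripEnds.2 ⟨1, fun s _ hs => ?_⟩)
  rw [one_mul, norm_pow, norm_inv, norm_inv, norm_pow, Real.norm_eq_abs, pow_add, inv_pow,
    inv_pow]
  exact mul_le_of_le_one_left (by positivity) (inv_le_one_of_one_le₀ (one_le_pow₀ hs))

theorem inv_sub_sub_inv_sub_isBigO_stripEnds (B : ℝ) (p q : ℂ) :
    (fun s => (s - p)⁻¹ - (s - q)⁻¹) =O[stripEnds B] fun s => (s.im ^ 2 : ℝ)⁻¹ := by
  have h := ((inv_sub_isBigO_stripEnds B p).mul (inv_sub_isBigO_stripEnds B q)).const_mul_left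
    (p - q)
  refine (h.congr' (eventually_stripEnds.2 ⟨|p.im| + |q.im| + 1, fun s _ hs => ?_⟩)
    (.of_forall fun s => ?_))
  · have hp : s - p ≠ 0 := fun h0 => by
      rw [sub_eq_zero.1 h0] at hs; linarith [abs_nonneg q.im]
    have hq : s - q ≠ 0 := fun h0 => by
      rw [sub_eq_zero.1 h0] at hs; linarith [abs_nonneg p.im]
    simp only
    field_simp
    ring
  · simp only; rw [← mul_inv, sq]

/-- A primitive in a vertical strip of a function with quadratic decay has a limit at the upper
end of the strip. -/
theorem exists_tendsto_of_im_tendsto_atTop {B : ℝ} {P f : ℂ → ℂ}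
    (hf : DifferentiableOn ℂ f (verticalStrip B))
    (hP : ∀ s ∈ verticalStrip B, HasDerivAt P (f s) s)
    (hdec : f =O[stripEnds B] fun s => (s.im ^ 2 : ℝ)⁻¹) :
    ∃ L : ℂ, ∀ (l : Filter ℝ) (γ : ℝ → ℂ), (∀ t, |(γ t).re| < B) →
      Tendsto (fun t => (γ t).im) l atTop → Tendsto (fun t => P (γ t)) l (𝓝 L) := by
  rcases le_or_gt B 0 with hB | hB
  · exact ⟨0, fun l γ hγ => absurd (hγ 0) (by linarith [abs_nonneg (γ 0).re])⟩
  obtain ⟨C, hC⟩ := hdec.bound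
  obtain ⟨M, hM⟩ := eventually_stripEnds.1 hC
  have hMbound : ∀ s : ℂ, |s.re| < B → max M 1 ≤ s.im → ‖f s‖ ≤ C * (s.im ^ 2)⁻¹ := by
    intro s hs hs'
    have h0 : 0 ≤ s.im := zero_le_one.trans ((le_max_right _ _).trans hs')
    have := hM s hs (by rw [abs_of_nonneg h0]; exact (le_max_left _ _).trans hs')
    rwa [norm_inv, norm_pow, Real.norm_eq_abs, sq_abs] at this
  have hC0 : 0 ≤ C := by
    have h := hMbound ⟨0, max M 1⟩ (by simpa) le_rfl
    have h2 : 0 < ((max M 1) ^ 2)⁻¹ := by positivity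
    exact nonneg_of_mul_nonneg_left ((norm_nonneg _).trans h) h2
  have hmem : ∀ y : ℝ, (y : ℂ) * Complex.I ∈ verticalStrip B := fun y => by
    simp [verticalStrip, hB]
  have hd : ∀ y : ℝ, HasDerivAt (fun y : ℝ => (y : ℂ) * Complex.I) Complex.I y := fun y => by
    simpa using (Complex.ofRealCLM.hasDerivAt (x := y)).mul_const Complex.I
  have hderiv : ∀ y ∈ Set.Ioi (max M 1), HasDerivAt (fun y : ℝ => P (y * Complex.I))
      (f (y * Complex.I) * Complex.I) y := fun y _ => by
    exact (hP _ (hmem y)).comp y (hd y)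
  have hcont : Continuous fun y : ℝ => f (y * Complex.I) * Complex.I := by
    refine (hf.continuousOn.comp_continuous (by fun_prop) hmem).mul continuous_const
  have hint : IntegrableOn (fun y : ℝ => f (y * Complex.I) * Complex.I) (Set.Ioi (max M 1)) := by
    have hpos : 0 < max M 1 := zero_lt_one.trans_le (le_max_right _ _)
    have h1 := (integrableOn_Ioi_rpow_of_lt (a := -2) (by norm_num) hpos).const_mul C
    refine h1.mono' hcont.aestronglyMeasurable ?_
    refine (ae_restrict_iff' measurableSet_Ioi).2 (.of_forall fun y hy => ?_)
    have := hMbound (y * Complex.I) (hmem y) (by simpa using (le_of_lt hy : max M 1 ≤ y))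
    have hy0 : 0 ≤ y := (hpos.trans hy).le
    rw [norm_mul, Complex.norm_I, mul_one]
    rw [Real.rpow_neg hy0]
    simpa using this
  obtain ⟨L, hlim⟩ : ∃ L, Tendsto (fun y : ℝ => P (y * Complex.I)) atTop (𝓝 L) :=
    ⟨_, tendsto_limUnder_of_hasDerivAt_of_integrableOn_Ioi hderiv hint⟩
  refine ⟨L, fun l γ hγ him => ?_⟩
  have hlim2 := hlim.comp him
  -- The horizontal segment from the imaginary axis to the path has length less than `B`, and the
  -- derivative of `P` on it is O(Im⁻²). So the limit along the axis is also the limit along the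
  -- path.
  have hdiff : Tendsto (fun t => P (γ t) - P ((γ t).im * Complex.I)) l (𝓝 0) := by
    have hz : Tendsto (fun t => C * ((γ t).im ^ 2)⁻¹ * B) l (𝓝 0) := by
      have : Tendsto (fun t => ((γ t).im ^ 2)⁻¹) l (𝓝 0) :=
        tendsto_inv_atTop_zero.comp ((tendsto_pow_atTop two_ne_zero).comp him)
      simpa using (this.const_mul C).mul_const B
    refine squeeze_zero_norm' ?_ hz
    filter_upwards [him.eventually_ge_atTop (max M 1)] with t ht
    have hconv := (convex_verticalStrip B).inter
      ((convex_halfSpace_im_ge (γ t).im).inter (convex_halfSpace_im_le (γ t).im))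
    have hle := hconv.norm_image_sub_le_of_norm_hasDerivWithin_le (f := P) (f' := f)
      (C := C * ((γ t).im ^ 2)⁻¹) (x := (γ t).im * Complex.I) (y := γ t)
      (fun s hs => (hP s hs.1).hasDerivWithinAt) (fun s hs => by
        have : s.im = (γ t).im := le_antisymm hs.2.2 hs.2.1
        rw [← this]
        exact hMbound s hs.1 (this ▸ ht)) ⟨hmem _, by simp⟩ ⟨hγ t, by simp⟩
    refine hle.trans (mul_le_mul_of_nonneg_left ?_ (by positivity))
    have e : γ t - (γ t).im * Complex.I = ((γ t).re : ℂ) := by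
      apply Complex.ext <;> simp
    rw [e, Complex.norm_real, Real.norm_eq_abs]
    exact (hγ t).le
  simpa using hdiff.add hlim2

/-- The strip is convex, so `f` has a primitive there, and its limits at the two ends do not depend
on the path. The lower end is reduced to the upper one by s ↦ -s. -/
theorem exists_forall_hasContourIntegral_of_differentiableOn {B : ℝ} {f : ℂ → ℂ}
    (hf : DifferentiableOn ℂ f (verticalStrip B))
    (hdec : f =O[stripEnds B] fun s => (s.im ^ 2 : ℝ)⁻¹) :
    ∃ J : ℂ, ∀ γ, IsVerticalPath γ → (∀ t, |(γ t).re| < B) → HasContourIntegral γ f J := by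
  obtain ⟨P, hP'⟩ := (convex_verticalStrip B).exists_forall_hasDerivWithinAt hf
  have hP : ∀ s ∈ verticalStrip B, HasDerivAt P (f s) s := fun s hs =>
    (hP' s hs).hasDerivAt ((isOpen_verticalStrip B).mem_nhds hs)
  obtain ⟨L₁, h₁⟩ := exists_tendsto_of_im_tendsto_atTop hf hP hdec
  have hneg : ∀ s ∈ verticalStrip B, -s ∈ verticalStrip B := fun s hs => by
    simpa [verticalStrip] using hs
  have hf2 : DifferentiableOn ℂ (fun s => -f (-s)) (verticalStrip B) :=
    (hf.comp differentiable_neg.differentiableOn hneg).neg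
  have hdec2 : (fun s => -f (-s)) =O[stripEnds B] fun s => (s.im ^ 2 : ℝ)⁻¹ := by
    have := (hdec.comp_tendsto (tendsto_neg_stripEnds B)).neg_left
    simpa [Function.comp_def] using this
  obtain ⟨L₂, h₂⟩ := exists_tendsto_of_im_tendsto_atTop (P := fun s => P (-s)) hf2
    (fun s hs => ((hP _ (hneg s hs)).comp s (hasDerivAt_neg s)).congr_deriv (by simp)) hdec2
  refine ⟨L₁ - L₂, fun γ hγ hB => ?_⟩
  refine hγ.piecewiseC1.hasContourIntegral_of_primitive (fun t => hP _ (hB t)) ?_ ?_ ?_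
  · exact hf.continuousOn.comp_continuous hγ.piecewiseC1.1 hB
  · have := h₂ atBot (fun t => -γ t) (fun t => by simpa using hB t)
      (by simpa using hγ.tendsto_bot)
    simpa using this
  · exact h₁ atTop γ hB hγ.tendsto_top

/-! ### Principal parts and path independence for meromorphic functions. -/

/-- Induction on the pole order: h(s) = h(p) + (s - p)·(divided difference of h at p), and the
divided difference is again analytic at p. -/
theorem AnalyticAt.exists_inv_pow_mul_eq {p : ℂ} (n : ℕ) {h : ℂ → ℂ} (hh : AnalyticAt ℂ h p) :
    ∃ (c : ℕ → ℂ) (φ : ℂ → ℂ), AnalyticAt ℂ φ p ∧ ∀ s ≠ p,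
      ((s - p)⁻¹) ^ n * h s = ∑ k ∈ Finset.range n, c k * ((s - p)⁻¹) ^ (k + 1) + φ s := by
  induction n generalizing h with
  | zero => exact ⟨0, h, hh, fun s _ => by simp⟩
  | succ n ih =>
    obtain ⟨P, hP⟩ := hh
    obtain ⟨c, φ, hφ, hc⟩ := ih ⟨_, hP.has_fpower_series_dslope_fslope⟩
    refine ⟨fun k => if k = n then h p else c k, φ, hφ, fun s hs => ?_⟩
    have hs' : s - p ≠ 0 := sub_ne_zero.2 hs
    have hsum : ∑ k ∈ Finset.range n, (if k = n then h p else c k) * ((s - p)⁻¹) ^ (k + 1) =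
        ∑ k ∈ Finset.range n, c k * ((s - p)⁻¹) ^ (k + 1) :=
      Finset.sum_congr rfl fun k hk => by rw [if_neg (Finset.mem_range.1 hk).ne]
    simp only [Finset.sum_range_succ, hsum, if_true]
    rw [add_right_comm, ← hc s hs, dslope_of_ne _ hs, slope_def_field]
    rw [pow_succ]
    field_simp
    ring

/-- The principal part of a meromorphic function at a point. -/
theorem MeromorphicAt.exists_principalPart {f : ℂ → ℂ} {p : ℂ} (hf : MeromorphicAt f p) :
    ∃ (n : ℕ) (c : ℕ → ℂ) (φ : ℂ → ℂ), AnalyticAt ℂ φ p ∧ ∀ s ≠ p,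
      f s = ∑ k ∈ Finset.range n, c k * ((s - p)⁻¹) ^ (k + 1) + φ s := by
  obtain ⟨n, hn⟩ := hf
  obtain ⟨c, φ, hφ, h⟩ := hn.exists_inv_pow_mul_eq n
  refine ⟨n, c, φ, hφ, fun s hs => ?_⟩
  rw [← h s hs, smul_eq_mul, ← mul_assoc, ← mul_pow, inv_mul_cancel₀ (sub_ne_zero.2 hs), one_pow,
    one_mul]

theorem HasContourIntegral.sum {ι : Type*} {γ : ℝ → ℂ} {f : ι → ℂ → ℂ} {J : ι → ℂ} (u : Finset ι)
    (h : ∀ i ∈ u, HasContourIntegral γ (f i) (J i)) :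
    HasContourIntegral γ (fun s => ∑ i ∈ u, f i s) (∑ i ∈ u, J i) := by
  classical
  induction u using Finset.induction_on with
  | empty => simp [HasContourIntegral]
  | insert i u hi ih =>
    simp only [Finset.sum_insert hi]
    exact (h i (by simp)).add (ih fun j hj => h j (by simp [hj]))

/-- A vertical path in the strip of half-width `B` that has the points of `X` on its left and
those of `Y` on its right. -/
structure SeparatesInStrip (B : ℝ) (X Y : Set ℂ) (γ : ℝ → ℂ) : Prop where
  vertical : IsVerticalPath γ
  abs_re_lt : ∀ t, |(γ t).re| < B
  left : ∀ p ∈ X, LiesLeft γ p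
  right : ∀ p ∈ Y, LiesRight γ p

/-- The `k`-th elementary fraction at `p`; the one with a simple pole is compensated by a pole at
`q`. -/
noncomputable def elementaryFraction (p q : ℂ) (k : ℕ) (s : ℂ) : ℂ :=
  ((s - p)⁻¹) ^ (k + 1) - if k = 0 then (s - q)⁻¹ else 0

theorem elementaryFraction_isBigO_stripEnds (B : ℝ) (p q : ℂ) (k : ℕ) :
    elementaryFraction p q k =O[stripEnds B] fun s => (s.im ^ 2 : ℝ)⁻¹ := by
  unfold elementaryFraction
  rcases k with _ | k
  · simpa using inv_sub_sub_inv_sub_isBigO_stripEnds B p q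
  · simpa using inv_sub_pow_isBigO_stripEnds B p k

theorem IsVerticalPath.hasContourIntegral_elementaryFraction {γ : ℝ → ℂ} (hγ : IsVerticalPath γ)
    {p q : ℂ} (h : JoinedIn (Set.range γ)ᶜ p q) (k : ℕ) :
    HasContourIntegral γ (elementaryFraction p q k) 0 := by
  unfold elementaryFraction
  rcases k with _ | k
  · simpa using hγ.hasContourIntegral_inv_sub_of_joinedIn h
  · simpa using hγ.hasContourIntegral_inv_sub_pow h.source_mem k

/-- The integral of a meromorphic function with quadratic decay in a vertical strip is the same
along all paths that separate its poles in the same way. -/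
theorem exists_forall_hasContourIntegral_of_meromorphic {B : ℝ} {X Y : Set ℂ} (D : Finset ℂ)
    (hD : ∀ p ∈ D, p ∈ X ∪ Y ∧ |p.re| < B) {f : ℂ → ℂ}
    (hf : DifferentiableOn ℂ f (verticalStrip B \ D)) (hmer : ∀ p ∈ D, MeromorphicAt f p)
    (hdec : f =O[stripEnds B] fun s => (s.im ^ 2 : ℝ)⁻¹) :
    ∃ J : ℂ, ∀ γ, SeparatesInStrip B X Y γ → HasContourIntegral γ f J := by
  classical
  induction D using Finset.induction_on generalizing f with
  | empty =>
    obtain ⟨J, hJ⟩ := exists_forall_hasContourIntegral_of_differentiableOn (by simpa using hf) hdec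
    exact ⟨J, fun γ hγ => hJ γ hγ.vertical hγ.abs_re_lt⟩
  | insert p D hpD ih =>
    obtain ⟨hpXY, hpB⟩ := hD p (by simp)
    -- The compensating point lies outside the strip, so it adds no pole there, and it is chosen
    -- before the path. Compensation is needed because 1/(s - p) alone lacks the quadratic decay.
    obtain ⟨q, hqB, hq⟩ : ∃ q : ℂ, B < |q.re| ∧ ∀ γ, SeparatesInStrip B X Y γ →
        JoinedIn (Set.range γ)ᶜ p q := by
      have hB : 0 < B := (abs_nonneg _).trans_lt hpB
      rcases hpXY with h | h
      · refine ⟨-((B + 1 : ℝ) : ℂ), ?_, fun γ hγ =>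
          IsVerticalPath.joinedIn_neg_of_liesLeft hγ.abs_re_lt (hγ.left p h)⟩
        rw [Complex.neg_re, Complex.ofReal_re, abs_neg, abs_of_pos (by linarith)]
        linarith
      · refine ⟨((B + 1 : ℝ) : ℂ), ?_, fun γ hγ =>
          IsVerticalPath.joinedIn_of_liesRight hγ.abs_re_lt (hγ.right p h)⟩
        rw [Complex.ofReal_re, abs_of_pos (by linarith)]
        linarith
    have hqs : ∀ s ∈ verticalStrip B, s - q ≠ 0 := fun s hs h0 => by
      rw [sub_eq_zero.1 h0] at hs
      exact hqB.not_gt hs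
    obtain ⟨n, c, φ, hφ, hfφ⟩ := (hmer p (by simp)).exists_principalPart
    set g : ℂ → ℂ := fun s => ∑ k ∈ Finset.range n, c k * elementaryFraction p q k s with hg
    have hgdiff : ∀ s ∈ verticalStrip B, s ≠ p → DifferentiableAt ℂ g s := by
      intro s hs hsp
      have h1 : DifferentiableAt ℂ (fun s => (s - p)⁻¹) s :=
        (differentiableAt_id.sub_const p).inv (sub_ne_zero.2 hsp)
      have h2 : DifferentiableAt ℂ (fun s => (s - q)⁻¹) s :=
        (differentiableAt_id.sub_const q).inv (hqs s hs)
      refine DifferentiableAt.fun_sum fun k _ => DifferentiableAt.const_mul ?_ _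
      unfold elementaryFraction
      split_ifs
      · exact (h1.pow _).sub h2
      · exact (h1.pow _).sub (differentiableAt_const _)
    set ψ : ℂ → ℂ := fun s => φ s + ∑ k ∈ Finset.range n, c k * (if k = 0 then (s - q)⁻¹ else 0)
      with hψ
    have hψdiff : DifferentiableAt ℂ ψ p := by
      have h2 : DifferentiableAt ℂ (fun s => (s - q)⁻¹) p :=
        (differentiableAt_id.sub_const q).inv (hqs p hpB)
      refine hφ.differentiableAt.add (DifferentiableAt.fun_sum fun k _ => ?_)
      refine DifferentiableAt.const_mul ?_ _
      split_ifs
      · exact h2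
      · exact differentiableAt_const _
    have hfg : ∀ s ≠ p, f s - g s = ψ s := by
      intro s hs
      rw [hfφ s hs]
      simp only [hg, hψ, elementaryFraction, mul_sub, Finset.sum_sub_distrib]
      ring
    -- Redefining the difference at `p` fills the removable singularity, so the induction hypothesis
    -- for the remaining poles applies to `F`.
    set F : ℂ → ℂ := Function.update (fun s => f s - g s) p (ψ p) with hF
    have hFne : ∀ s ≠ p, F s = f s - g s := fun s hs => Function.update_of_ne hs _ _
    have hFψ : F = ψ := by
      ext s
      by_cases hs : s = p
      · rw [hs, hF, Function.update_self]
      · rw [hFne s hs, hfg s hs]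
    have hdecg : g =O[stripEnds B] fun s => (s.im ^ 2 : ℝ)⁻¹ :=
      Asymptotics.IsBigO.fun_sum fun k _ =>
        (elementaryFraction_isBigO_stripEnds B p q k).const_mul_left _
    have hne : ∀ᶠ s in stripEnds B, s ≠ p := eventually_stripEnds.2
      ⟨|p.im| + 1, fun s _ hs h => by rw [h] at hs; linarith⟩
    obtain ⟨J, hJ⟩ := ih (f := F) (fun r hr => hD r (by simp [hr])) (by
      intro s hs
      by_cases hsp : s = p
      · rw [hFψ, hsp]
        exact hψdiff.differentiableWithinAt
      · have hopen : IsOpen (verticalStrip B \ ((insert p D : Finset ℂ) : Set ℂ)) :=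
          (isOpen_verticalStrip B).sdiff (Finset.finite_toSet _).isClosed
        have hmem : s ∈ verticalStrip B \ ((insert p D : Finset ℂ) : Set ℂ) :=
          ⟨hs.1, by
            rw [Finset.mem_coe, Finset.mem_insert, not_or]
            exact ⟨hsp, hs.2⟩⟩
        have h1 : DifferentiableAt ℂ (fun s => f s - g s) s :=
          (hf.differentiableAt (hopen.mem_nhds hmem)).sub (hgdiff s hs.1 hsp)
        refine (h1.congr_of_eventuallyEq ?_).differentiableWithinAt
        filter_upwards [isOpen_ne.mem_nhds hsp] with r hr using hFne r hr) (by
      intro r hr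
      have hrp : r ≠ p := fun h => hpD (h ▸ hr)
      have hgr : MeromorphicAt g r := by
        have hev : ∀ᶠ s in 𝓝 r, DifferentiableAt ℂ g s := by
          filter_upwards [isOpen_ne.mem_nhds hrp,
            (isOpen_verticalStrip B).mem_nhds (hD r (by simp [hr])).2] with s hs hs'
          exact hgdiff s hs' hs
        exact (Complex.analyticAt_iff_eventually_differentiableAt.2 hev).meromorphicAt
      refine ((hmer r (by simp [hr])).sub hgr).congr ?_
      refine mem_nhdsWithin_of_mem_nhds ?_
      filter_upwards [isOpen_ne.mem_nhds hrp] with s hs using (hFne s hs).symm)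
      ((hdec.sub hdecg).congr' (hne.mono fun s hs => (hFne s hs).symm) .rfl)
    refine ⟨J, fun γ hγ => ?_⟩
    have hpγ := (hq γ hγ).source_mem
    have hgint : HasContourIntegral γ g 0 := by
      simpa using HasContourIntegral.sum (Finset.range n) fun k _ =>
        (hγ.vertical.hasContourIntegral_elementaryFraction (hq γ hγ) k).const_mul (c k)
    have hsum := (hJ γ hγ).add hgint
    rw [add_zero] at hsum
    refine hsum.congr fun t => ?_
    rw [hFne _ fun h => hpγ ⟨t, h⟩]
    ring

/-! ### Exponential decay of the Gamma function. -/

open Complex in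
theorem integrableOn_cpow_mul_cexp_neg_mul {a r : ℂ} (ha : 0 < a.re) (hr : 0 < r.re) :
    IntegrableOn (fun t : ℝ => (t : ℂ) ^ (a - 1) * cexp (-(r * t))) (Set.Ioi 0) := by
  have h := integrableOn_rpow_mul_exp_neg_mul_rpow (s := a.re - 1) (p := 1) (by linarith) one_pos hr
  refine Integrable.mono' h ?_ ?_
  · refine ContinuousOn.aestronglyMeasurable ?_ measurableSet_Ioi
    refine ContinuousOn.mul (fun t ht => ?_) (by fun_prop)
    exact (continuousAt_ofReal_cpow_const _ _ (Or.inr (ne_of_gt ht))).continuousWithinAt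
  · refine (ae_restrict_iff' measurableSet_Ioi).2 (.of_forall fun t ht => ?_)
    rw [norm_mul, norm_cpow_eq_rpow_re_of_pos ht, norm_exp]
    simp

open Complex in
theorem differentiableAt_integral_cpow_mul_cexp_neg_mul {a r₀ : ℂ} (ha : 0 < a.re) (hr : 0 < r₀.re) :
    DifferentiableAt ℂ (fun r : ℂ => ∫ t : ℝ in Set.Ioi 0, (t : ℂ) ^ (a - 1) * cexp (-(r * t)))
      r₀ := by
  have hnhds : {r : ℂ | r₀.re / 2 < r.re} ∈ 𝓝 r₀ :=
    (isOpen_lt continuous_const continuous_re).mem_nhds (by simp only [Set.mem_ofPred_eq]; linarith)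
  have hbound : IntegrableOn (fun t : ℝ => t ^ a.re * Real.exp (-(r₀.re / 2) * t)) (Set.Ioi 0) := by
    simpa using integrableOn_rpow_mul_exp_neg_mul_rpow (s := a.re) (p := 1) (b := r₀.re / 2)
      (by linarith) one_pos (by linarith)
  have hmeas : ∀ r : ℂ, AEStronglyMeasurable
      (fun t : ℝ => (t : ℂ) ^ (a - 1) * cexp (-(r * t))) (volume.restrict (Set.Ioi 0)) := by
    intro r
    refine ContinuousOn.aestronglyMeasurable ?_ measurableSet_Ioi
    refine ContinuousOn.mul (fun t ht => ?_) (by fun_prop)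
    exact (continuousAt_ofReal_cpow_const _ _ (Or.inr (ne_of_gt ht))).continuousWithinAt
  refine (hasDerivAt_integral_of_dominated_loc_of_deriv_le (𝕜 := ℂ)
    (F' := fun r (t : ℝ) => (t : ℂ) ^ (a - 1) * (cexp (-(r * t)) * (-t))) hnhds
    (.of_forall hmeas) (integrableOn_cpow_mul_cexp_neg_mul ha hr) ?_ ?_ hbound
    ?_).2.differentiableAt
  · refine ContinuousOn.aestronglyMeasurable ?_ measurableSet_Ioi
    refine ContinuousOn.mul (fun t ht => ?_) (by fun_prop)
    exact (continuousAt_ofReal_cpow_const _ _ (Or.inr (ne_of_gt ht))).continuousWithinAt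
  · refine (ae_restrict_iff' measurableSet_Ioi).2 (.of_forall fun t ht r hr' => ?_)
    have ht0 : (0 : ℝ) < t := ht
    rw [norm_mul, norm_mul, norm_cpow_eq_rpow_re_of_pos ht, norm_exp, norm_neg, norm_real,
      Real.norm_of_nonneg ht0.le, mul_comm (Real.exp _), ← mul_assoc]
    have e : t ^ (a - 1).re * t = t ^ a.re := by
      rw [sub_re, one_re, Real.rpow_sub_one ht0.ne', div_mul_cancel₀ _ ht0.ne']
    rw [e]
    refine mul_le_mul_of_nonneg_left (Real.exp_le_exp.2 ?_) (Real.rpow_nonneg ht0.le _)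
    have : (r₀.re / 2) * t ≤ r.re * t := mul_le_mul_of_nonneg_right (le_of_lt hr') ht0.le
    simpa using this
  · refine .of_forall fun t r _ => HasDerivAt.const_mul _ ?_
    have h1 : HasDerivAt (fun r : ℂ => -(r * t)) (-(1 * (t : ℂ))) r :=
      ((hasDerivAt_id r).mul_const (t : ℂ)).neg
    simpa using h1.cexp

open Complex in
/-- Euler's integral for the Gamma function along a rotated ray. -/
theorem integral_cpow_mul_cexp_neg_mul {a r : ℂ} (ha : 0 < a.re) (hr : 0 < r.re) :
    ∫ t : ℝ in Set.Ioi 0, (t : ℂ) ^ (a - 1) * cexp (-(r * t)) = r ^ (-a) * Gamma a := by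
  have hopen : IsOpen {r : ℂ | 0 < r.re} := isOpen_lt continuous_const continuous_re
  have h1 : AnalyticOnNhd ℂ
      (fun r : ℂ => ∫ t : ℝ in Set.Ioi 0, (t : ℂ) ^ (a - 1) * cexp (-(r * t)))
      {r : ℂ | 0 < r.re} :=
    DifferentiableOn.analyticOnNhd (fun r hr =>
      (differentiableAt_integral_cpow_mul_cexp_neg_mul ha hr).differentiableWithinAt) hopen
  have h2 : AnalyticOnNhd ℂ (fun r : ℂ => r ^ (-a) * Gamma a) {r : ℂ | 0 < r.re} := by
    refine DifferentiableOn.analyticOnNhd (fun r hr => ?_) hopen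
    refine DifferentiableAt.differentiableWithinAt ?_
    refine DifferentiableAt.mul_const ?_ _
    exact differentiableAt_id.cpow_const (Or.inl hr)
  -- Both sides are analytic in the right half-plane and agree at real r > 1, which accumulate at 1.
  refine h1.eqOn_of_preconnected_of_frequently_eq h2
    (convex_halfSpace_re_gt 0).isPreconnected (z₀ := 1) (by simp) ?_ hr
  have hseq : Tendsto (fun x : ℝ => (x : ℂ)) (𝓝[>] 1) (𝓝[≠] 1) := by
    refine tendsto_nhdsWithin_iff.2 ⟨?_, ?_⟩
    · exact (continuous_ofReal.tendsto' 1 1 (by simp)).mono_left nhdsWithin_le_nhds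
    · filter_upwards [self_mem_nhdsWithin] with x hx h
      exact (ne_of_gt (show (1 : ℝ) < x from hx)) (by exact_mod_cast (show (x : ℂ) = 1 from h))
  refine hseq.frequently (Eventually.frequently ?_)
  filter_upwards [self_mem_nhdsWithin] with x hx
  have hx0 : 0 < x := zero_lt_one.trans hx
  rw [integral_cpow_mul_exp_neg_mul_Ioi ha hx0, one_div, inv_cpow, cpow_neg]
  rw [arg_ofReal_of_nonneg hx0.le]
  exact Real.pi_pos.ne

-- Take r = exp(iθ) with θ = ±π/3 in the rotated Euler integral. The factor r^(-s) has modulus exp(θ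
-- Im s), and θ is given the sign of Im s. As cos θ = 1/2, the integral is bounded by that of t^(Re
-- s - 1) exp(-t/2), which is the source of the power of 2. An angle above π/4 is what lets four
-- factors beat exp(π|Im s|).
open Complex in
theorem norm_Gamma_le_of_re_pos {s : ℂ} (hs : 0 < s.re) :
    ‖Gamma s‖ ≤ 2 ^ s.re * Real.Gamma s.re * Real.exp (-(Real.pi / 3) * |s.im|) := by
  have key : ∀ θ : ℝ, |θ| = Real.pi / 3 →
      ‖Gamma s‖ * Real.exp (θ * s.im) ≤ 2 ^ s.re * Real.Gamma s.re := by
    intro θ hθ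
    have hcos : Real.cos θ = 1 / 2 := by rw [← Real.cos_abs, hθ, Real.cos_pi_div_three]
    have hre : (cexp (θ * I)).re = 1 / 2 := by rw [exp_ofReal_mul_I_re, hcos]
    have h := integral_cpow_mul_cexp_neg_mul hs (r := cexp (θ * I)) (by rw [hre]; norm_num)
    have hlog : log (cexp (θ * I)) = θ * I := by
      have := abs_le.1 hθ.le
      refine log_exp ?_ ?_ <;> simp <;> linarith [Real.pi_pos]
    have hpow : ‖cexp (θ * I) ^ (-s)‖ = Real.exp (θ * s.im) := by
      rw [cpow_def_of_ne_zero (exp_ne_zero _), hlog, norm_exp]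
      simp
    rw [mul_comm, ← hpow, ← norm_mul, ← h]
    have h2 := Real.integral_rpow_mul_exp_neg_mul_Ioi hs (r := 1 / 2) (by norm_num)
    have e : (1 / (1 / 2) : ℝ) = 2 := by norm_num
    rw [e] at h2
    rw [← h2]
    refine (norm_integral_le_integral_norm _).trans (le_of_eq ?_)
    refine setIntegral_congr_fun measurableSet_Ioi fun t ht => ?_
    change ‖(t : ℂ) ^ (s - 1) * cexp (-(cexp (θ * I) * t))‖ = _
    rw [norm_mul, norm_cpow_eq_rpow_re_of_pos ht, norm_exp]
    congr 2
    rw [neg_re, re_mul_ofReal, hre]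
  rw [neg_mul, Real.exp_neg, ← div_eq_mul_inv, le_div_iff₀ (Real.exp_pos _)]
  have hpi : 0 < Real.pi / 3 := by positivity
  rcases le_total 0 s.im with h | h
  · rw [abs_of_nonneg h]; exact key _ (abs_of_pos hpi)
  · rw [abs_of_nonpos h, mul_neg, ← neg_mul]; exact key _ (by rw [abs_neg, abs_of_pos hpi])

-- In the functional equation each factor s + k has modulus at least |Im s| ≥ 1. This reduces bounds
-- in any strip to the right half-plane.
open Complex in
theorem norm_Gamma_le_norm_Gamma_add_nat {s : ℂ} (hs : 1 ≤ |s.im|) (n : ℕ) :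
    ‖Gamma s‖ ≤ ‖Gamma (s + n)‖ := by
  induction n with
  | zero => simp
  | succ n ih =>
    have him : |(s + n).im| = |s.im| := by simp
    have h1 : 1 ≤ ‖s + n‖ := hs.trans (him ▸ abs_im_le_norm _)
    have hne : s + n ≠ 0 := norm_pos_iff.1 (zero_lt_one.trans_le h1)
    rw [Nat.cast_succ, ← add_assoc, Gamma_add_one _ hne, norm_mul]
    exact ih.trans (le_mul_of_one_le_left (norm_nonneg _) h1)

open Complex in
/-- Exponential decay of the Gamma function in vertical strips. -/
theorem exists_norm_Gamma_le (A B : ℝ) : ∃ C : ℝ, ∀ s : ℂ, A ≤ s.re → s.re ≤ B → 1 ≤ |s.im| →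
    ‖Gamma s‖ ≤ C * Real.exp (-(Real.pi / 3) * |s.im|) := by
  obtain ⟨n, hn⟩ := exists_nat_ge (1 - A)
  have hcont : ContinuousOn (fun x : ℝ => (2 : ℝ) ^ x * Real.Gamma x) (Set.Icc 1 (B + n)) := by
    refine ContinuousOn.mul (fun x _ => ?_) (fun x hx => ?_)
    · exact (Real.continuous_const_rpow two_ne_zero).continuousWithinAt
    · exact (Real.differentiableOn_Gamma_Ioi.continuousOn.mono (fun y hy =>
        (zero_lt_one.trans_le hy.1 : (0 : ℝ) < y)) x hx)
  obtain ⟨C, hC⟩ := isCompact_Icc.exists_bound_of_continuousOn hcont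
  refine ⟨C, fun s hA hB him => ?_⟩
  have hre : (s + n).re = s.re + n := by simp
  have h1 : 1 ≤ (s + n).re := by rw [hre]; linarith
  have h2 := norm_Gamma_le_of_re_pos (zero_lt_one.trans_le h1)
  have h3 := (le_abs_self _).trans (hC (s + n).re ⟨h1, by rw [hre]; linarith⟩)
  have h4 : (s + n).im = s.im := by simp
  rw [h4] at h2
  exact (norm_Gamma_le_norm_Gamma_add_nat him n).trans
    (h2.trans (mul_le_mul_of_nonneg_right h3 (Real.exp_pos _).le))

theorem Gamma_const_add_isBigO_stripEnds (B : ℝ) (a : ℂ) :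
    (fun s => Complex.Gamma (a + s)) =O[stripEnds B]
      fun s => Real.exp (-(Real.pi / 3) * |s.im|) := by
  obtain ⟨C, hC⟩ := exists_norm_Gamma_le (a.re - B) (a.re + B)
  refine Asymptotics.IsBigO.of_bound (|C| * Real.exp (Real.pi / 3 * |a.im|))
    (eventually_stripEnds.2 ⟨|a.im| + 1, fun s hs him => ?_⟩)
  have hs' := abs_lt.1 hs
  have h1 : |s.im| - |a.im| ≤ |(a + s).im| := by
    rw [Complex.add_im, add_comm, ← sub_neg_eq_add]
    exact (by simpa using abs_sub_abs_le_abs_sub s.im (-a.im))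
  have h2 := hC (a + s) (by rw [Complex.add_re]; linarith) (by rw [Complex.add_re]; linarith)
    (by linarith)
  rw [Real.norm_of_nonneg (Real.exp_pos _).le, mul_assoc, ← Real.exp_add]
  refine h2.trans (mul_le_mul (le_abs_self C) (Real.exp_le_exp.2 ?_) (Real.exp_pos _).le
    (abs_nonneg _))
  have := mul_le_mul_of_nonneg_left h1 (by positivity : 0 ≤ Real.pi / 3)
  linarith

theorem Gamma_const_sub_isBigO_stripEnds (B : ℝ) (e : ℂ) :
    (fun s => Complex.Gamma (e - s)) =O[stripEnds B]
      fun s => Real.exp (-(Real.pi / 3) * |s.im|) := by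
  simpa [Function.comp_def, sub_eq_add_neg] using
    (Gamma_const_add_isBigO_stripEnds B e).comp_tendsto (tendsto_neg_stripEnds B)

theorem exp_neg_mul_abs_im_isBigO_stripEnds (B : ℝ) {δ : ℝ} (hδ : 0 < δ) :
    (fun s : ℂ => Real.exp (-δ * |s.im|)) =O[stripEnds B] fun s => (s.im ^ 2 : ℝ)⁻¹ := by
  have h := (isLittleO_exp_neg_mul_rpow_atTop hδ (-2)).isBigO
  have htend : Tendsto (fun s : ℂ => |s.im|) (stripEnds B) atTop :=
    tendsto_comap.mono_left inf_le_left
  refine (h.comp_tendsto htend).trans (Asymptotics.isBigO_of_le _ fun s => ?_)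
  simp

/-! ### The Barnes kernel and independence of the path. -/

/-- The integrand of Barnes' integrals. -/
noncomputable def barnesKernel (a b e d s : ℂ) : ℂ :=
  Complex.Gamma (a + s) * Complex.Gamma (b + s) * Complex.Gamma (e - s) * Complex.Gamma (d - s)

theorem barnesKernel_isBigO_stripEnds (B : ℝ) (a b e d : ℂ) :
    barnesKernel a b e d =O[stripEnds B] fun s => Real.exp (-(4 * Real.pi / 3) * |s.im|) := by
  have h := (((Gamma_const_add_isBigO_stripEnds B a).mul
    (Gamma_const_add_isBigO_stripEnds B b)).mul (Gamma_const_sub_isBigO_stripEnds B e)).mul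
    (Gamma_const_sub_isBigO_stripEnds B d)
  refine h.congr_right fun s => ?_
  rw [← Real.exp_add, ← Real.exp_add, ← Real.exp_add]
  congr 1
  ring

theorem barnesKernel_mul_isBigO_stripEnds {B : ℝ} (a b e d : ℂ) {φ : ℂ → ℂ} {κ : ℝ}
    (hφ : φ =O[stripEnds B] fun s => Real.exp (κ * |s.im|)) :
    (fun s => barnesKernel a b e d s * φ s) =O[stripEnds B]
      fun s => Real.exp (-(4 * Real.pi / 3 - κ) * |s.im|) := by
  refine ((barnesKernel_isBigO_stripEnds B a b e d).mul hφ).congr_right fun s => ?_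
  rw [← Real.exp_add]
  congr 1
  ring

/-- A vertical path with the poles of `Γ(a+s)Γ(b+s)` on its left and the poles of `Γ(e-s)Γ(d-s)`
on its right. -/
structure SeparatesPoles (a b e d : ℂ) (γ : ℝ → ℂ) : Prop where
  vertical : IsVerticalPath γ
  left_a : ∀ n : ℕ, LiesLeft γ (-a - n)
  left_b : ∀ n : ℕ, LiesLeft γ (-b - n)
  right_e : ∀ n : ℕ, LiesRight γ (e + n)
  right_d : ∀ n : ℕ, LiesRight γ (d + n)

theorem LiesLeft.notMem_range {γ : ℝ → ℂ} {p : ℂ} (h : LiesLeft γ p) : p ∉ Set.range γ :=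
  h.exists.elim fun _ hx => hx.source_mem

theorem LiesRight.notMem_range {γ : ℝ → ℂ} {p : ℂ} (h : LiesRight γ p) : p ∉ Set.range γ :=
  h.exists.elim fun _ hx => hx.source_mem

namespace SeparatesPoles

variable {a b e d : ℂ} {γ : ℝ → ℂ}

theorem swap_left (h : SeparatesPoles a b e d γ) : SeparatesPoles b a e d γ :=
  ⟨h.vertical, h.left_b, h.left_a, h.right_e, h.right_d⟩

theorem swap_right (h : SeparatesPoles a b e d γ) : SeparatesPoles a b d e γ :=
  ⟨h.vertical, h.left_a, h.left_b, h.right_d, h.right_e⟩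

theorem raise_left (h : SeparatesPoles a b e d γ) : SeparatesPoles (a + 1) b e d γ :=
  ⟨h.vertical, fun n => by
    have := h.left_a (n + 1)
    rwa [show -(a + 1) - (n : ℂ) = -a - ((n + 1 : ℕ) : ℂ) by push_cast; ring], h.left_b,
    h.right_e, h.right_d⟩

theorem raise_right (h : SeparatesPoles a b e d γ) : SeparatesPoles a b (e + 1) d γ :=
  ⟨h.vertical, h.left_a, h.left_b, fun n => by
    have := h.right_e (n + 1)
    rwa [show e + 1 + (n : ℂ) = e + ((n + 1 : ℕ) : ℂ) by push_cast; ring], h.right_d⟩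

theorem const_add_ne (h : SeparatesPoles a b e d γ) (t : ℝ) (n : ℕ) : a + γ t ≠ -n := fun h0 =>
  (h.left_a n).notMem_range ⟨t, by linear_combination h0⟩

theorem const_sub_ne (h : SeparatesPoles a b e d γ) (t : ℝ) (n : ℕ) : e - γ t ≠ -n := fun h0 =>
  (h.right_e n).notMem_range ⟨t, by linear_combination -h0⟩

end SeparatesPoles

theorem finite_setOf_abs_re_add_mul_lt (c : ℂ) (ε : ℝ) (hε : |ε| = 1) (B : ℝ) :
    {p : ℂ | (∃ n : ℕ, p = c + ε * n) ∧ |p.re| < B}.Finite := by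
  obtain ⟨N, hN⟩ := exists_nat_ge (|c.re| + B)
  refine ((Set.finite_Iic N).image fun n : ℕ => c + ε * n).subset ?_
  rintro p ⟨⟨n, rfl⟩, hp⟩
  refine ⟨n, ?_, rfl⟩
  have h1 : (c + ε * n).re = c.re + ε * n := by simp
  have h2 : |ε * n| = n := by rw [abs_mul, hε, one_mul, Nat.abs_cast]
  rw [h1] at hp
  have h3 : |ε * n| ≤ |c.re + ε * n| + |c.re| := by
    have := abs_sub (c.re + ε * n) c.re
    simpa using this
  rw [h2] at h3
  have : (n : ℝ) ≤ N := by linarith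
  exact_mod_cast this

theorem meromorphicAt_barnesKernel (a b e d s : ℂ) : MeromorphicAt (barnesKernel a b e d) s := by
  have h1 : ∀ c : ℂ, MeromorphicAt (fun s => Complex.Gamma (c + s)) s := fun c =>
    (Meromorphic.Gamma (c + s)).comp_analyticAt (g := fun s => c + s) (by fun_prop)
  have h2 : ∀ c : ℂ, MeromorphicAt (fun s => Complex.Gamma (c - s)) s := fun c =>
    (Meromorphic.Gamma (c - s)).comp_analyticAt (g := fun s => c - s) (by fun_prop)
  exact (((h1 a).mul (h1 b)).mul (h2 e)).mul (h2 d)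

theorem differentiableAt_barnesKernel {a b e d s : ℂ} (ha : ∀ n : ℕ, a + s ≠ -n)
    (hb : ∀ n : ℕ, b + s ≠ -n) (he : ∀ n : ℕ, e - s ≠ -n) (hd : ∀ n : ℕ, d - s ≠ -n) :
    DifferentiableAt ℂ (barnesKernel a b e d) s := by
  have h1 : ∀ c : ℂ, (∀ n : ℕ, c + s ≠ -n) →
      DifferentiableAt ℂ (fun s => Complex.Gamma (c + s)) s := fun c hc =>
    DifferentiableAt.comp s (Complex.differentiableAt_Gamma _ hc) (by fun_prop)
  have h2 : ∀ c : ℂ, (∀ n : ℕ, c - s ≠ -n) →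
      DifferentiableAt ℂ (fun s => Complex.Gamma (c - s)) s := fun c hc =>
    DifferentiableAt.comp s (Complex.differentiableAt_Gamma _ hc) (by fun_prop)
  exact (((h1 a ha).mul (h1 b hb)).mul (h2 e he)).mul (h2 d hd)

/-- Barnes' integrals do not depend on the path, as long as it separates the poles. -/
theorem SeparatesPoles.exists_hasContourIntegral {a b e d : ℂ} {γ₁ γ₂ : ℝ → ℂ}
    (h₁ : SeparatesPoles a b e d γ₁) (h₂ : SeparatesPoles a b e d γ₂) {φ : ℂ → ℂ} {κ : ℝ}
    (hφ : Differentiable ℂ φ) (hκ : κ < 4 * Real.pi / 3)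
    (hdec : ∀ B, φ =O[stripEnds B] fun s => Real.exp (κ * |s.im|)) :
    ∃ J, HasContourIntegral γ₁ (fun s => barnesKernel a b e d s * φ s) J ∧
      HasContourIntegral γ₂ (fun s => barnesKernel a b e d s * φ s) J := by
  obtain ⟨B₁, hB₁⟩ := h₁.vertical.bounded_re
  obtain ⟨B₂, hB₂⟩ := h₂.vertical.bounded_re
  set B := max B₁ B₂ + 1
  have hB1 : ∀ t, |(γ₁ t).re| < B := fun t =>
    (hB₁ t).trans_lt ((le_max_left _ _).trans_lt (lt_add_one _))
  have hB2 : ∀ t, |(γ₂ t).re| < B := fun t =>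
    (hB₂ t).trans_lt ((le_max_right _ _).trans_lt (lt_add_one _))
  set X : Set ℂ := {p | ∃ n : ℕ, p = -a - n} ∪ {p | ∃ n : ℕ, p = -b - n} with hX
  set Y : Set ℂ := {p | ∃ n : ℕ, p = e + n} ∪ {p | ∃ n : ℕ, p = d + n} with hY
  -- Only finitely many poles meet the strip, since each of the four sequences moves horizontally by
  -- unit steps.
  have hfin : {p | p ∈ X ∪ Y ∧ |p.re| < B}.Finite := by
    refine ((((finite_setOf_abs_re_add_mul_lt (-a) (-1) (by simp) B).union
      (finite_setOf_abs_re_add_mul_lt (-b) (-1) (by simp) B)).union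
      (finite_setOf_abs_re_add_mul_lt e 1 (by simp) B)).union
      (finite_setOf_abs_re_add_mul_lt d 1 (by simp) B)).subset ?_
    rintro p ⟨((⟨n, rfl⟩ | ⟨n, rfl⟩) | (⟨n, rfl⟩ | ⟨n, rfl⟩)), hp⟩
    · exact Or.inl (Or.inl (Or.inl ⟨⟨n, by push_cast; ring⟩, hp⟩))
    · exact Or.inl (Or.inl (Or.inr ⟨⟨n, by push_cast; ring⟩, hp⟩))
    · exact Or.inl (Or.inr ⟨⟨n, by push_cast; ring⟩, hp⟩)
    · exact Or.inr ⟨⟨n, by push_cast; ring⟩, hp⟩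
  have key : ∀ γ, SeparatesPoles a b e d γ → (∀ t, |(γ t).re| < B) → SeparatesInStrip B X Y γ := by
    intro γ hγ hγB
    refine ⟨hγ.vertical, hγB, ?_, ?_⟩
    · rintro p (⟨n, rfl⟩ | ⟨n, rfl⟩)
      exacts [hγ.left_a n, hγ.left_b n]
    · rintro p (⟨n, rfl⟩ | ⟨n, rfl⟩)
      exacts [hγ.right_e n, hγ.right_d n]
  obtain ⟨J, hJ⟩ := exists_forall_hasContourIntegral_of_meromorphic (B := B) (X := X) (Y := Y)
    hfin.toFinset (f := fun s => barnesKernel a b e d s * φ s) (fun p hp => hfin.mem_toFinset.1 hp)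
    (fun s hs => by
      have hs2 : s ∉ X ∪ Y := fun h => hs.2 (Finset.mem_coe.2 (hfin.mem_toFinset.2 ⟨h, hs.1⟩))
      refine (DifferentiableAt.mul (differentiableAt_barnesKernel ?_ ?_ ?_ ?_)
        (hφ s)).differentiableWithinAt
      · exact fun n h => hs2 (Or.inl (Or.inl ⟨n, by linear_combination h⟩))
      · exact fun n h => hs2 (Or.inl (Or.inr ⟨n, by linear_combination h⟩))
      · exact fun n h => hs2 (Or.inr (Or.inl ⟨n, by linear_combination -h⟩))
      · exact fun n h => hs2 (Or.inr (Or.inr ⟨n, by linear_combination -h⟩)))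
    (fun p _ => (meromorphicAt_barnesKernel a b e d p).mul
      (hφ.analyticAt p).meromorphicAt)
    ((barnesKernel_mul_isBigO_stripEnds a b e d (hdec B)).trans
      (exp_neg_mul_abs_im_isBigO_stripEnds B (by linarith)))
  exact ⟨J, hJ γ₁ (key γ₁ h₁ hB1), hJ γ₂ (key γ₂ h₂ hB2)⟩

theorem SeparatesPoles.exists_hasContourIntegral_barnesKernel {a b e d : ℂ} {γ₁ γ₂ : ℝ → ℂ}
    (h₁ : SeparatesPoles a b e d γ₁) (h₂ : SeparatesPoles a b e d γ₂) :
    ∃ J, HasContourIntegral γ₁ (barnesKernel a b e d) J ∧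
      HasContourIntegral γ₂ (barnesKernel a b e d) J := by
  simpa using h₁.exists_hasContourIntegral h₂ (φ := fun _ => 1) (κ := 0)
    (differentiable_const _) (by positivity)
    (fun B => by
      simpa using Asymptotics.isBigO_const_const (1 : ℂ) (one_ne_zero : (1 : ℝ) ≠ 0) (stripEnds B))

/-! ### Translation of the path and contiguous relations. -/

theorem LiesLeft.add_one {γ : ℝ → ℂ} {p : ℂ} (h : LiesLeft γ p) :
    LiesLeft (fun t => γ t + 1) (p + 1) := by
  have h1 := (tendsto_atTop_add_const_right atTop (1 : ℝ) tendsto_id).eventually h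
  filter_upwards [h1] with x hx
  have := (hx.map (f := fun s => s + 1) (by fun_prop)).mono (V := (Set.range fun t => γ t + 1)ᶜ) ?_
  · simpa using this
  · rintro _ ⟨s, hs, rfl⟩ ⟨t, ht⟩
    exact hs ⟨t, add_right_cancel ht⟩

theorem LiesRight.add_one {γ : ℝ → ℂ} {p : ℂ} (h : LiesRight γ p) :
    LiesRight (fun t => γ t + 1) (p + 1) := by
  have h1 := (tendsto_atTop_add_const_right atTop (-1 : ℝ) tendsto_id).eventually h
  filter_upwards [h1] with x hx
  have := (hx.map (f := fun s => s + 1) (by fun_prop)).mono (V := (Set.range fun t => γ t + 1)ᶜ) ?_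
  · simpa using this
  · rintro _ ⟨s, hs, rfl⟩ ⟨t, ht⟩
    exact hs ⟨t, add_right_cancel ht⟩

theorem IsVerticalPath.add_one {γ : ℝ → ℂ} (h : IsVerticalPath γ) :
    IsVerticalPath fun t => γ t + 1 := by
  obtain ⟨⟨hc, S, hS, hd⟩, ⟨B, hB⟩, hbot, htop⟩ := h
  refine ⟨⟨hc.add continuous_const, S, hS, fun u v huv hdis =>
    (hd u v huv hdis).add contDiffOn_const⟩, ⟨B + 1, fun t => ?_⟩, by simpa using hbot,
    by simpa using htop⟩
  rw [Complex.add_re, Complex.one_re]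
  exact (abs_add_le _ _).trans (by simpa using hB t)

/-- The right-hand poles move along with the path. On the left, the translated sequences start one
step further right than required, so `a` and `b` need not change. -/
theorem SeparatesPoles.add_one {a b e d : ℂ} {γ : ℝ → ℂ} (h : SeparatesPoles a b e d γ) :
    SeparatesPoles a b (e + 1) (d + 1) fun t => γ t + 1 := by
  refine ⟨h.vertical.add_one, fun n => ?_, fun n => ?_, fun n => ?_, fun n => ?_⟩
  · simpa [← sub_sub] using (h.left_a (n + 1)).add_one
  · simpa [← sub_sub] using (h.left_b (n + 1)).add_one
  · simpa [add_right_comm] using (h.right_e n).add_one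
  · simpa [add_right_comm] using (h.right_d n).add_one

/-- With K the kernel for (a, b, e + 1, d + 1), the integrand is K(s + 1) - K(s) by the functional
equation of Γ. Both the path and its translate by 1 separate the poles of K, so the two integrals
cancel. -/
theorem SeparatesPoles.hasContourIntegral_mul_quadratic {a b e d : ℂ} {γ : ℝ → ℂ}
    (h : SeparatesPoles a b e d γ) : HasContourIntegral γ
      (fun s => barnesKernel a b e d s * ((a + s) * (b + s) - (e - s) * (d - s))) 0 := by
  obtain ⟨J, hJ₁, hJ₂⟩ := h.add_one.exists_hasContourIntegral_barnesKernel
    h.raise_right.swap_right.raise_right.swap_right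
  have := hJ₁.of_add_const.sub hJ₂
  rw [sub_self] at this
  refine this.congr fun t => ?_
  have ha := h.const_add_ne t 0
  have hb := h.swap_left.const_add_ne t 0
  have he := h.const_sub_ne t 0
  have hd := h.swap_right.const_sub_ne t 0
  simp only [Nat.cast_zero, neg_zero] at ha hb he hd
  unfold barnesKernel
  rw [show a + (γ t + 1) = (a + γ t) + 1 by ring, show b + (γ t + 1) = (b + γ t) + 1 by ring,
    show e + 1 - (γ t + 1) = e - γ t by ring, show d + 1 - (γ t + 1) = d - γ t by ring,
    show e + 1 - γ t = (e - γ t) + 1 by ring, show d + 1 - γ t = (d - γ t) + 1 by ring,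
    Complex.Gamma_add_one _ ha, Complex.Gamma_add_one _ hb, Complex.Gamma_add_one _ he,
    Complex.Gamma_add_one _ hd]
  ring

/-- This rests on the identity (a+b+e+d)(a+s) - (a+e)(a+d) = (a+s)(b+s) - (e-s)(d-s), in which the
s² terms on the right cancel. -/
theorem SeparatesPoles.contiguous_left {a b e d J J' : ℂ} {γ : ℝ → ℂ}
    (h : SeparatesPoles a b e d γ) (hJ : HasContourIntegral γ (barnesKernel a b e d) J)
    (hJ' : HasContourIntegral γ (barnesKernel (a + 1) b e d) J') :
    (a + e) * (a + d) * J = (a + b + e + d) * J' := by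
  have h1 := (hJ'.const_mul (a + b + e + d)).sub (hJ.const_mul ((a + e) * (a + d)))
  have h2 : HasContourIntegral γ (fun s => (a + b + e + d) * barnesKernel (a + 1) b e d s -
      (a + e) * (a + d) * barnesKernel a b e d s) 0 := by
    refine h.hasContourIntegral_mul_quadratic.congr fun t => ?_
    have ha := h.const_add_ne t 0
    simp only [Nat.cast_zero, neg_zero] at ha
    unfold barnesKernel
    rw [show a + 1 + γ t = (a + γ t) + 1 by ring, Complex.Gamma_add_one _ ha]
    ring
  linear_combination -(h1.unique h2)

/-- Here the identity is (a+e)(b+e) - (a+b+e+d)(e-s) = (a+s)(b+s) - (e-s)(d-s). -/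
theorem SeparatesPoles.contiguous_right {a b e d J J' : ℂ} {γ : ℝ → ℂ}
    (h : SeparatesPoles a b e d γ) (hJ : HasContourIntegral γ (barnesKernel a b e d) J)
    (hJ' : HasContourIntegral γ (barnesKernel a b (e + 1) d) J') :
    (a + e) * (b + e) * J = (a + b + e + d) * J' := by
  have h1 := (hJ.const_mul ((a + e) * (b + e))).sub (hJ'.const_mul (a + b + e + d))
  have h2 : HasContourIntegral γ (fun s => (a + e) * (b + e) * barnesKernel a b e d s -
      (a + b + e + d) * barnesKernel a b (e + 1) d s) 0 := by
    refine h.hasContourIntegral_mul_quadratic.congr fun t => ?_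
    have he := h.const_sub_ne t 0
    simp only [Nat.cast_zero, neg_zero] at he
    unfold barnesKernel
    rw [show e + 1 - γ t = (e - γ t) + 1 by ring, Complex.Gamma_add_one _ he]
    ring
  linear_combination h1.unique h2

/-! ### The Beta integral over the half-line. -/

theorem ofReal_cpow_eq_cexp {r : ℝ} (hr : 0 < r) (w : ℂ) :
    (r : ℂ) ^ w = Complex.exp (Real.log r * w) := by
  rw [Complex.cpow_def_of_ne_zero (by exact_mod_cast hr.ne'), Complex.ofReal_log hr.le]

theorem image_div_one_sub_Ioo :
    (fun u : ℝ => u / (1 - u)) '' Set.Ioo 0 1 = Set.Ioi 0 := by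
  ext t
  constructor
  · rintro ⟨u, hu, rfl⟩
    exact div_pos hu.1 (sub_pos.2 hu.2)
  · intro ht
    have ht0 : (0 : ℝ) < t := ht
    refine ⟨t / (1 + t), ⟨by positivity, by rw [div_lt_one (by positivity)]; linarith⟩, ?_⟩
    simp only
    have : 1 - t / (1 + t) = 1 / (1 + t) := by field_simp; ring
    rw [this]
    field_simp

theorem injOn_div_one_sub_Ioo : Set.InjOn (fun u : ℝ => u / (1 - u)) (Set.Ioo 0 1) := by
  intro u hu v hv h
  have h1 : 1 - u ≠ 0 := (sub_pos.2 hu.2).ne'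
  have h2 : 1 - v ≠ 0 := (sub_pos.2 hv.2).ne'
  simp only at h
  rw [div_eq_div_iff h1 h2] at h
  linarith

theorem hasDerivWithinAt_div_one_sub {u : ℝ} (hu : u ∈ Set.Ioo (0 : ℝ) 1) :
    HasDerivWithinAt (fun u : ℝ => u / (1 - u)) (1 / (1 - u) ^ 2) (Set.Ioo 0 1) u := by
  have h1 : 1 - u ≠ 0 := (sub_pos.2 hu.2).ne'
  have := (hasDerivAt_id u).div ((hasDerivAt_id u).const_sub 1) h1
  refine (this.congr_deriv ?_).hasDerivWithinAt
  simp

theorem abs_deriv_smul_beta_integrand (x y : ℂ) {u : ℝ} (hu : u ∈ Set.Ioo (0 : ℝ) 1) :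
    |1 / (1 - u) ^ 2| • (((u / (1 - u) : ℝ) : ℂ) ^ (x - 1) *
      ((1 + u / (1 - u) : ℝ) : ℂ) ^ (-(x + y))) =
    (u : ℂ) ^ (x - 1) * (1 - (u : ℂ)) ^ (y - 1) := by
  have h0 := hu.1
  have h1 : 0 < 1 - u := sub_pos.2 hu.2
  have e1 : 1 + u / (1 - u) = (1 - u)⁻¹ := by field_simp; ring
  have e2 : |1 / (1 - u) ^ 2| = Real.exp (-2 * Real.log (1 - u)) := by
    rw [abs_of_pos (by positivity), neg_mul, Real.exp_neg, ← Real.log_rpow h1, Real.exp_log]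
    · simp
    · positivity
  have e3 : (1 : ℂ) - u = ((1 - u : ℝ) : ℂ) := by push_cast; rfl
  rw [e1, e2, e3, ofReal_cpow_eq_cexp (div_pos h0 h1), ofReal_cpow_eq_cexp (inv_pos.2 h1),
    ofReal_cpow_eq_cexp h0, ofReal_cpow_eq_cexp h1, Complex.real_smul, Complex.ofReal_exp,
    ← Complex.exp_add, ← Complex.exp_add, ← Complex.exp_add, Real.log_div h0.ne' h1.ne',
    Real.log_inv]
  congr 1
  push_cast
  ring

theorem integrableOn_beta_Ioi {x y : ℂ} (hx : 0 < x.re) (hy : 0 < y.re) :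
    IntegrableOn (fun t : ℝ => (t : ℂ) ^ (x - 1) * ((1 + t : ℝ) : ℂ) ^ (-(x + y)))
      (Set.Ioi 0) := by
  rw [← image_div_one_sub_Ioo, integrableOn_image_iff_integrableOn_abs_deriv_smul measurableSet_Ioo
    (fun u hu => hasDerivWithinAt_div_one_sub hu) injOn_div_one_sub_Ioo]
  have h := Complex.betaIntegral_convergent hx hy
  rw [intervalIntegrable_iff_integrableOn_Ioo_of_le zero_le_one] at h
  exact h.congr_fun (fun u hu => (abs_deriv_smul_beta_integrand x y hu).symm) measurableSet_Ioo

/-- The Beta integral over the positive half-line. -/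
theorem integral_beta_Ioi {x y : ℂ} (hx : 0 < x.re) (hy : 0 < y.re) :
    ∫ t : ℝ in Set.Ioi 0, (t : ℂ) ^ (x - 1) * ((1 + t : ℝ) : ℂ) ^ (-(x + y)) =
      Complex.Gamma x * Complex.Gamma y / Complex.Gamma (x + y) := by
  rw [← Complex.betaIntegral_eq_Gamma_mul_div x y hx hy, Complex.betaIntegral,
    intervalIntegral.integral_of_le zero_le_one, integral_Ioc_eq_integral_Ioo,
    ← image_div_one_sub_Ioo, integral_image_eq_integral_abs_deriv_smul measurableSet_Ioo
    (fun u hu => hasDerivWithinAt_div_one_sub hu) injOn_div_one_sub_Ioo]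
  exact setIntegral_congr_fun measurableSet_Ioo fun u hu => abs_deriv_smul_beta_integrand x y hu

theorem Gamma_add_mul_integral_beta_Ioi {x y : ℂ} (hx : 0 < x.re) (hy : 0 < y.re) :
    Complex.Gamma (x + y) *
      ∫ t : ℝ in Set.Ioi 0, (t : ℂ) ^ (x - 1) * ((1 + t : ℝ) : ℂ) ^ (-(x + y)) =
      Complex.Gamma x * Complex.Gamma y := by
  rw [integral_beta_Ioi hx hy, mul_div_cancel₀]
  exact Complex.Gamma_ne_zero_of_re_pos (by rw [Complex.add_re]; linarith)

/-! ### Barnes' first lemma on the imaginary axis. -/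

theorem integrable_exp_neg_mul_abs {δ : ℝ} (hδ : 0 < δ) :
    Integrable fun y : ℝ => Real.exp (-δ * |y|) := by
  rw [← integrableOn_univ, ← Set.Iic_union_Ioi (a := (0 : ℝ))]
  refine IntegrableOn.union ?_ ?_
  · refine (integrableOn_exp_mul_Iic hδ 0).congr_fun (fun y hy => ?_) measurableSet_Iic
    rw [abs_of_nonpos hy]; ring_nf
  · refine (integrableOn_exp_mul_Ioi (neg_neg_of_pos hδ) 0).congr_fun (fun y hy => ?_)
      measurableSet_Ioi
    rw [abs_of_pos hy]

theorem exists_norm_Gamma_add_mul_I_le {a : ℂ} (ha : 0 < a.re) :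
    ∃ C, 0 ≤ C ∧ ∀ y : ℝ, ‖Complex.Gamma (a + y * Complex.I)‖ ≤
      C * Real.exp (-(Real.pi / 3) * |y|) := by
  have hG : 0 < 2 ^ a.re * Real.Gamma a.re := mul_pos (by positivity) (Real.Gamma_pos_of_pos ha)
  refine ⟨2 ^ a.re * Real.Gamma a.re * Real.exp (Real.pi / 3 * |a.im|), by positivity,
    fun y => ?_⟩
  have hre : (a + y * Complex.I).re = a.re := by simp
  have him : (a + y * Complex.I).im = a.im + y := by simp
  have h := norm_Gamma_le_of_re_pos (s := a + y * Complex.I) (by rwa [hre])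
  rw [hre, him] at h
  refine h.trans ?_
  rw [mul_assoc (2 ^ a.re * Real.Gamma a.re), ← Real.exp_add]
  refine mul_le_mul_of_nonneg_left (Real.exp_le_exp.2 ?_) hG.le
  have h1 : |y| ≤ |a.im + y| + |a.im| := by simpa using abs_sub (a.im + y) a.im
  have := mul_le_mul_of_nonneg_left h1 (by positivity : 0 ≤ Real.pi / 3)
  linarith

theorem continuous_Gamma_add_mul_I {a : ℂ} (ha : 0 < a.re) :
    Continuous fun y : ℝ => Complex.Gamma (a + y * Complex.I) := by
  refine continuous_iff_continuousAt.2 fun y => ?_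
  have hc : ContinuousAt Complex.Gamma (a + y * Complex.I) :=
    Complex.continuousAt_Gamma _ fun m h => by
      have := congrArg Complex.re h
      simp at this
      have hm : (0 : ℝ) ≤ m := m.cast_nonneg
      linarith
  exact hc.comp (f := fun y : ℝ => a + y * Complex.I) (by fun_prop)

theorem integrable_Gamma_mul_Gamma {a d : ℂ} (ha : 0 < a.re) (hd : 0 < d.re) :
    Integrable fun y : ℝ => Complex.Gamma (a + y * Complex.I) * Complex.Gamma (d - y * Complex.I)
    := by
  obtain ⟨C, hC0, hC⟩ := exists_norm_Gamma_add_mul_I_le ha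
  obtain ⟨D, hD0, hD⟩ := exists_norm_Gamma_add_mul_I_le hd
  have hneg : ∀ y : ℝ, d - y * Complex.I = d + ((-y : ℝ) : ℂ) * Complex.I := fun y => by
    push_cast; ring
  simp only [hneg]
  refine ((integrable_exp_neg_mul_abs (δ := Real.pi / 3) (by positivity)).const_mul
    (C * D)).mono' ?_ (.of_forall fun y => ?_)
  · exact ((continuous_Gamma_add_mul_I ha).mul
      ((continuous_Gamma_add_mul_I hd).comp continuous_neg)).aestronglyMeasurable
  · rw [norm_mul]
    have h2 := hD (-y)
    have h3 : Real.exp (-(Real.pi / 3) * |-y|) ≤ 1 :=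
      Real.exp_le_one_iff.2 (mul_nonpos_of_nonpos_of_nonneg (by linarith [Real.pi_pos])
        (abs_nonneg _))
    calc _ ≤ (C * Real.exp (-(Real.pi / 3) * |y|)) * (D * 1) :=
          mul_le_mul (hC y) (h2.trans (mul_le_mul_of_nonneg_left h3 hD0)) (norm_nonneg _)
            (by positivity)
      _ = _ := by ring

theorem mellin_Gamma_mul_cpow {a d s : ℂ} (h1 : 0 < (a + s).re) (h2 : 0 < (d - s).re) :
    mellin (fun t : ℝ => Complex.Gamma (a + d) * ((t : ℂ) ^ a *
      ((1 + t : ℝ) : ℂ) ^ (-(a + d)))) s = Complex.Gamma (a + s) * Complex.Gamma (d - s) := by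
  rw [← Gamma_add_mul_integral_beta_Ioi h1 h2, mellin, ← integral_const_mul]
  refine setIntegral_congr_fun measurableSet_Ioi fun t ht => ?_
  simp only [smul_eq_mul]
  rw [show a + s + (d - s) = a + d by ring, show a + s - 1 = (s - 1) + a by ring,
    Complex.cpow_add _ _ (by exact_mod_cast (ne_of_gt (show (0 : ℝ) < t from ht)))]
  ring

/-- Mellin inversion on the imaginary axis, applied to the function whose Mellin transform is Γ(a +
s)Γ(d - s) by the Beta integral. -/
theorem integral_Gamma_mul_Gamma_mul_cpow {a d : ℂ} (ha : 0 < a.re) (hd : 0 < d.re) {u : ℝ}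
    (hu : 0 < u) :
    ∫ y : ℝ, (u : ℂ) ^ (-(y * Complex.I)) * (Complex.Gamma (a + y * Complex.I) *
      Complex.Gamma (d - y * Complex.I)) =
    2 * Real.pi * (Complex.Gamma (a + d) * ((u : ℂ) ^ a * ((1 + u : ℝ) : ℂ) ^ (-(a + d)))) := by
  set f : ℝ → ℂ := fun t : ℝ => Complex.Gamma (a + d) * ((t : ℂ) ^ a *
      ((1 + t : ℝ) : ℂ) ^ (-(a + d))) with hf
  have hmel : ∀ y : ℝ, mellin f (((0 : ℝ) : ℂ) + y * Complex.I) =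
      Complex.Gamma (a + y * Complex.I) * Complex.Gamma (d - y * Complex.I) := fun y => by
    rw [Complex.ofReal_zero, zero_add]
    exact mellin_Gamma_mul_cpow (by simpa) (by simpa)
  have hconv : MellinConvergent f ((0 : ℝ) : ℂ) := by
    have h0 : IntegrableOn (fun t : ℝ => Complex.Gamma (a + d) * ((t : ℂ) ^ (a - 1) *
        ((1 + t : ℝ) : ℂ) ^ (-(a + d)))) (Set.Ioi 0) :=
      (integrableOn_beta_Ioi ha hd).const_mul (Complex.Gamma (a + d))
    refine h0.congr_fun (fun t ht => ?_) measurableSet_Ioi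
    simp only [hf, smul_eq_mul, Complex.ofReal_zero, zero_sub]
    rw [sub_eq_neg_add,
      Complex.cpow_add _ _ (by exact_mod_cast (ne_of_gt (show (0 : ℝ) < t from ht)))]
    ring
  have hvert : Complex.VerticalIntegrable (mellin f) 0 := by
    refine (integrable_Gamma_mul_Gamma ha hd).congr (.of_forall fun y => (hmel y).symm)
  have hcont : ContinuousAt f u := by
    refine continuousAt_const.mul (ContinuousAt.mul ?_ ?_)
    · exact Complex.continuousAt_ofReal_cpow_const _ _ (Or.inr hu.ne')
    · have h1 : ContinuousAt (fun t : ℝ => (t : ℂ) ^ (-(a + d))) (1 + u) :=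
        Complex.continuousAt_ofReal_cpow_const _ _ (Or.inr (by positivity))
      exact h1.comp (f := fun t : ℝ => 1 + t) (by fun_prop)
  have h := mellinInv_mellin_eq 0 f hu hconv hvert hcont
  rw [mellinInv] at h
  simp only [hmel] at h
  simp only [Complex.ofReal_zero, zero_add, smul_eq_mul] at h
  change _ = 2 * Real.pi * f u
  rw [← h, Complex.real_smul]
  push_cast
  have : (Real.pi : ℂ) ≠ 0 := by exact_mod_cast Real.pi_ne_zero
  rw [← mul_assoc, mul_one_div_cancel (mul_ne_zero two_ne_zero this), one_mul]

/-- Write Γ(e - s)Γ(b + s) as a Beta integral over u and exchange the integrals. The inner integral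
over y is evaluated by Mellin inversion, and the remaining integral over u is again a Beta integral.
-/
theorem integral_barnesKernel_mul_I {a b e d : ℂ} (ha : 0 < a.re) (hb : 0 < b.re) (he : 0 < e.re)
    (hd : 0 < d.re) :
    ∫ y : ℝ, barnesKernel a b e d (y * Complex.I) =
      2 * Real.pi * (Complex.Gamma (a + e) * Complex.Gamma (a + d) * Complex.Gamma (b + e) *
        Complex.Gamma (b + d) / Complex.Gamma (a + b + e + d)) := by
  set M : ℝ → ℂ := fun y => Complex.Gamma (a + y * Complex.I) * Complex.Gamma (d - y * Complex.I)
    with hM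
  set w : ℝ → ℂ := fun u => (u : ℂ) ^ (e - 1) * ((1 + u : ℝ) : ℂ) ^ (-(e + b)) with hw
  have hMint : Integrable M := integrable_Gamma_mul_Gamma ha hd
  have hwint : IntegrableOn w (Set.Ioi 0) := integrableOn_beta_Ioi he hb
  have hker : ∀ y : ℝ, barnesKernel a b e d (y * Complex.I) =
      ∫ u : ℝ in Set.Ioi 0, Complex.Gamma (e + b) *
        ((u : ℂ) ^ (-(y * Complex.I)) * M y * w u) := by
    intro y
    have h := Gamma_add_mul_integral_beta_Ioi (x := e - y * Complex.I) (y := b + y * Complex.I)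
      (by simpa) (by simpa)
    have e1 : e - y * Complex.I + (b + y * Complex.I) = e + b := by ring
    rw [e1] at h
    have hk : barnesKernel a b e d (y * Complex.I) =
        M y * (Complex.Gamma (e - y * Complex.I) * Complex.Gamma (b + y * Complex.I)) := by
      simp only [barnesKernel, hM]; ring
    rw [hk, ← h, ← mul_assoc, mul_comm (M y), mul_assoc, ← integral_const_mul,
      ← integral_const_mul]
    refine setIntegral_congr_fun measurableSet_Ioi fun u hu => ?_
    simp only [hw]
    rw [show e - y * Complex.I - 1 = -(y * Complex.I) + (e - 1) by ring,
      Complex.cpow_add _ _ (by exact_mod_cast (ne_of_gt (show (0 : ℝ) < u from hu)))]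
    ring
  -- Since u^(-iy) has modulus 1 for u > 0, the integrand is dominated by a product of a function of
  -- y and a function of u, both integrable.
  have hprod : Integrable (Function.uncurry fun (y u : ℝ) => Complex.Gamma (e + b) *
        ((u : ℂ) ^ (-(y * Complex.I)) * M y * w u))
        (volume.prod (volume.restrict (Set.Ioi 0))) := by
    have h1 : Integrable (fun p : ℝ × ℝ => M p.1 * w p.2)
        (volume.prod (volume.restrict (Set.Ioi 0))) := hMint.mul_prod hwint
    have hmeas : Measurable fun p : ℝ × ℝ => (p.2 : ℂ) ^ (-(p.1 * Complex.I)) := by fun_prop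
    have h2 : Integrable (fun p : ℝ × ℝ => (p.2 : ℂ) ^ (-(p.1 * Complex.I)) * (M p.1 * w p.2))
        (volume.prod (volume.restrict (Set.Ioi 0))) := by
      refine h1.bdd_mul (c := 1) hmeas.aestronglyMeasurable ?_
      have hae : ∀ᵐ p : ℝ × ℝ ∂(volume.prod (volume.restrict (Set.Ioi 0))), 0 < p.2 := by
        have : ∀ᵐ u : ℝ ∂(volume.restrict (Set.Ioi 0)), 0 < u := ae_restrict_mem measurableSet_Ioi
        exact (Measure.quasiMeasurePreserving_snd (μ := (volume : Measure ℝ))).ae this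
      filter_upwards [hae] with p hp
      rw [Complex.norm_cpow_eq_rpow_re_of_pos hp]
      simp
    refine (h2.const_mul (Complex.Gamma (e + b))).congr (.of_forall fun p => ?_)
    simp only [Function.uncurry]
    ring
  simp only [hker]
  rw [integral_integral_swap hprod]
  have hinner : ∀ u ∈ Set.Ioi (0 : ℝ), ∫ y : ℝ, Complex.Gamma (e + b) *
      ((u : ℂ) ^ (-(y * Complex.I)) * M y * w u) =
      (2 * Real.pi * Complex.Gamma (e + b) * Complex.Gamma (a + d)) *
        ((u : ℂ) ^ (a + e - 1) * ((1 + u : ℝ) : ℂ) ^ (-(a + e + (b + d)))) := by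
    intro u hu
    have hu0 : (0 : ℝ) < u := hu
    rw [integral_const_mul, integral_mul_const, integral_Gamma_mul_Gamma_mul_cpow ha hd hu]
    rw [show a + e - 1 = a + (e - 1) by ring,
      Complex.cpow_add _ _ (by exact_mod_cast hu0.ne'),
      show -(a + e + (b + d)) = -(a + d) + -(e + b) by ring,
      Complex.cpow_add _ _ (by exact_mod_cast (by positivity : 1 + u ≠ 0))]
    simp only [hw]
    ring
  rw [setIntegral_congr_fun measurableSet_Ioi hinner, integral_const_mul,
    integral_beta_Ioi (by rw [Complex.add_re]; linarith) (by rw [Complex.add_re]; linarith),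
    show a + e + (b + d) = a + b + e + d by ring, add_comm e b]
  ring

/-! ### Construction of a path separating the poles. -/

/-- The graph `re = g (im)` in coordinates sheared by `ε`. -/
def shearedGraph (g : ℝ → ℝ) (ε t : ℝ) : ℂ := ⟨g t, t - ε * g t⟩

namespace shearedGraph

variable {g : ℝ → ℝ} {ε B : ℝ}

theorem eq_ofReal_add (g : ℝ → ℝ) (ε : ℝ) :
    shearedGraph g ε = fun t => (g t : ℂ) + ((t - ε * g t : ℝ) : ℂ) * Complex.I := by
  ext t
  apply Complex.ext <;> simp [shearedGraph]

theorem contDiff (hg : ContDiff ℝ 1 g) : ContDiff ℝ 1 (shearedGraph g ε) := by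
  rw [eq_ofReal_add]
  have h1 : ContDiff ℝ 1 fun t => ((g t : ℝ) : ℂ) := Complex.ofRealCLM.contDiff.comp hg
  have h2 : ContDiff ℝ 1 fun t => ((t - ε * g t : ℝ) : ℂ) :=
    Complex.ofRealCLM.contDiff.comp (contDiff_id.sub (contDiff_const.mul hg))
  exact h1.add (h2.mul contDiff_const)

theorem injective : Function.Injective (shearedGraph g ε) := by
  intro t t' h
  have h1 : g t = g t' := congrArg Complex.re h
  have h2 : t - ε * g t = t' - ε * g t' := congrArg Complex.im h
  rw [h1] at h2
  linarith

theorem abs_le_abs_im_add (hB : ∀ t, |g t| ≤ B) (t : ℝ) :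
    |t| ≤ |(shearedGraph g ε t).im| + |ε| * B := by
  have h1 : t = (shearedGraph g ε t).im + ε * g t := by simp [shearedGraph]
  calc |t| = |(shearedGraph g ε t).im + ε * g t| := by rw [← h1]
    _ ≤ |(shearedGraph g ε t).im| + |ε * g t| := abs_add_le _ _
    _ ≤ _ := by
      rw [abs_mul]
      gcongr
      exact hB t

theorem isVerticalPath (hg : ContDiff ℝ 1 g) (hB : ∀ t, |g t| ≤ B) :
    IsVerticalPath (shearedGraph g ε) := by
  have hε : ∀ t, |ε * g t| ≤ |ε| * B := fun t => by
    rw [abs_mul]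
    exact mul_le_mul_of_nonneg_left (hB t) (abs_nonneg _)
  refine ⟨⟨(contDiff hg).continuous, ∅, by simp, fun u v _ _ => (contDiff hg).contDiffOn⟩,
    ⟨B, hB⟩, ?_, ?_⟩
  · refine tendsto_atBot_mono (f := fun t => t + |ε| * B) (fun t => ?_)
      (tendsto_atBot_add_const_right _ _ tendsto_id)
    have := (abs_le.1 (hε t)).1
    simp only [shearedGraph]
    linarith
  · refine tendsto_atTop_mono (f := fun t => t + -(|ε| * B)) (fun t => ?_)
      (tendsto_atTop_add_const_right _ _ tendsto_id)
    have := (abs_le.1 (hε t)).2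
    simp only [shearedGraph]
    linarith

/-- First move with im + ε·re constant, away from the graph, until the real part is -σx; then move
vertically, where |re| exceeds the bound for `g`. The sign σ = 1 treats the left side, σ = -1 the
right. -/
theorem joinedIn (hB : ∀ t, |g t| ≤ B) {σ : ℝ} (hσ : |σ| = 1) {p : ℂ}
    (hp : σ * p.re < σ * g (p.im + ε * p.re)) {x : ℝ} (hx : B < x) (hxp : -(σ * p.re) ≤ x) :
    JoinedIn (Set.range (shearedGraph g ε))ᶜ p (-(σ * x : ℝ) : ℂ) := by
  have hσ2 : σ * σ = 1 := by rw [← abs_mul_abs_self, hσ, one_mul]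
  have hside : ∀ s : ℂ, σ * s.re < σ * g (s.im + ε * s.re) →
      s ∈ (Set.range (shearedGraph g ε))ᶜ := by
    rintro _ h ⟨t, rfl⟩
    simp [shearedGraph] at h
  have hfar : ∀ y, -x < σ * g y := fun y => by
    have h1 : |σ * g y| ≤ B := by rw [abs_mul, hσ, one_mul]; exact hB y
    linarith [(abs_le.1 h1).1]
  set q : ℂ := ⟨-(σ * x), p.im + ε * p.re + ε * (σ * x)⟩ with hq
  have h1 : JoinedIn (Set.range (shearedGraph g ε))ᶜ p q := by
    refine JoinedIn.of_segment_subset ?_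
    rintro _ ⟨α, β, hα, hβ, hαβ, rfl⟩
    apply hside
    have hre : (α • p + β • q).re = α * p.re - β * (σ * x) := by simp [hq]; ring
    have him : (α • p + β • q).im + ε * (α • p + β • q).re = p.im + ε * p.re := by
      rw [hre]
      simp only [hq, Complex.add_im, Complex.real_smul, Complex.im_ofReal_mul]
      linear_combination (p.im + ε * p.re) * hαβ
    rw [him, hre]
    refine lt_of_le_of_lt ?_ hp
    have e : σ * (α * p.re - β * (σ * x)) = α * (σ * p.re) - β * x := by
      linear_combination (-β * x) * hσ2
    rw [e]
    have h2 : -x ≤ σ * p.re := by linarith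
    calc α * (σ * p.re) - β * x = α * (σ * p.re) + β * (-x) := by ring
      _ ≤ α * (σ * p.re) + β * (σ * p.re) := by gcongr
      _ = σ * p.re := by rw [← add_mul, hαβ, one_mul]
  have h2 : JoinedIn (Set.range (shearedGraph g ε))ᶜ q (-(σ * x : ℝ) : ℂ) := by
    refine JoinedIn.of_segment_subset ?_
    rintro _ ⟨α, β, hα, hβ, hαβ, rfl⟩
    apply hside
    have hre : (α • q + β • (-((σ * x : ℝ) : ℂ))).re = -(σ * x) := by
      simp only [hq, Complex.add_re, Complex.real_smul, Complex.re_ofReal_mul, Complex.neg_re,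
        Complex.ofReal_re]
      linear_combination (-(σ * x)) * hαβ
    have e : σ * -(σ * x) = -x := by linear_combination (-x) * hσ2
    rw [hre, e]
    exact hfar _
  exact h1.trans h2

theorem liesLeft (hB : ∀ t, |g t| ≤ B) {p : ℂ} (hp : p.re < g (p.im + ε * p.re)) :
    LiesLeft (shearedGraph g ε) p := by
  filter_upwards [eventually_gt_atTop B, eventually_ge_atTop (-p.re)] with x hx hx'
  simpa using joinedIn hB (σ := 1) (by simp) (by simpa using hp) hx (by simpa using hx')

theorem liesRight (hB : ∀ t, |g t| ≤ B) {p : ℂ} (hp : g (p.im + ε * p.re) < p.re) :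
    LiesRight (shearedGraph g ε) p := by
  filter_upwards [eventually_gt_atTop B, eventually_ge_atTop p.re] with x hx hx'
  simpa using joinedIn hB (σ := -1) (by simp) (by simpa using hp) hx (by simpa using hx')

end shearedGraph

/-- Two points with different real parts share a sheared height for just one value of ε, and
distinct points with equal real parts never do. So only finitely many ε are excluded. -/
theorem exists_shear_separating {P Q : Set ℂ} (hP : P.Finite) (hQ : Q.Finite) (hPQ : Disjoint P Q) :
    ∃ ε : ℝ, ∀ p ∈ P, ∀ q ∈ Q, p.im + ε * p.re ≠ q.im + ε * q.re := by
  have hfin := (hP.prod hQ).image fun r : ℂ × ℂ => (r.2.im - r.1.im) / (r.1.re - r.2.re)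
  obtain ⟨ε, hε⟩ := hfin.exists_notMem
  refine ⟨ε, fun p hp q hq h => ?_⟩
  by_cases hre : p.re = q.re
  · refine Set.disjoint_left.1 hPQ hp ?_
    have : p = q := Complex.ext hre (by rw [hre] at h; linarith)
    rwa [this]
  · refine hε ⟨(p, q), ⟨hp, hq⟩, ?_⟩
    have : p.re - q.re ≠ 0 := sub_ne_zero.2 hre
    field_simp
    linarith

-- The function is B - 2B·f with f a smooth bump equal to 1 on `T` and 0 on `S`. Making f vanish
-- outside a large ball bounds the derivative.
open scoped Manifold in
theorem exists_contDiff_eq_on_finite {S T : Set ℝ} (hS : S.Finite) (hT : T.Finite)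
    (hST : Disjoint S T) {B : ℝ} (hB : 0 ≤ B) :
    ∃ g : ℝ → ℝ, ContDiff ℝ 1 g ∧ (∀ t, |g t| ≤ B) ∧ (∀ t ∈ S, g t = B) ∧ (∀ t ∈ T, g t = -B) ∧
      ∃ M, ∀ t, |deriv g t| ≤ M := by
  obtain ⟨R, hR⟩ := hT.isBounded.subset_ball 0
  obtain ⟨f, hf0, hf1, hf⟩ := exists_contMDiffMap_zero_one_of_isClosed (n := 1) 𝓘(ℝ, ℝ)
    (s := S ∪ (Metric.ball 0 R)ᶜ) (t := T) (hS.isClosed.union Metric.isOpen_ball.isClosed_compl)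
    hT.isClosed (Set.disjoint_union_left.2 ⟨hST, Set.disjoint_left.2 fun x hx hx' => hx (hR hx')⟩)
  have hfc : ContDiff ℝ 1 f := f.contMDiff.contDiff
  have hgc : ContDiff ℝ 1 fun t => B - 2 * B * f t := contDiff_const.sub (contDiff_const.mul hfc)
  refine ⟨fun t => B - 2 * B * f t, hgc, fun t => ?_, fun t ht => ?_, fun t ht => ?_, ?_⟩
  · have := hf t
    rw [abs_le]
    constructor <;> nlinarith [this.1, this.2]
  · simp [hf0 (Or.inl ht)]
  · change B - 2 * B * f t = -B
    rw [hf1 ht, Pi.one_apply]; ring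
  · have hcont : Continuous (deriv fun t => B - 2 * B * f t) := hgc.continuous_deriv le_rfl
    obtain ⟨M, hM⟩ := (isCompact_closedBall (0 : ℝ) R).exists_bound_of_continuousOn
      hcont.continuousOn
    refine ⟨max M 0, fun t => ?_⟩
    by_cases ht : t ∈ Metric.closedBall (0 : ℝ) R
    · exact (hM t ht).trans (le_max_left _ _)
    · have hev : (fun t => B - 2 * B * f t) =ᶠ[𝓝 t] fun _ => B := by
        filter_upwards [Metric.isClosed_closedBall.isOpen_compl.mem_nhds ht] with r hr
        have : f r = 0 := hf0 (Or.inr fun h => hr (Metric.ball_subset_closedBall h))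
        simp [this]
      rw [hev.deriv_eq]
      simp

/-- There is a smooth path without self-intersections that separates the poles. -/
theorem exists_separatesPoles {a b e d : ℂ} (hae : Admissible (a + e)) (had : Admissible (a + d))
    (hbe : Admissible (b + e)) (hbd : Admissible (b + d)) :
    ∃ γ : ℝ → ℂ, Function.Injective γ ∧ SeparatesPoles a b e d γ ∧ ContDiff ℝ 1 γ ∧
      (∃ M, ∀ t, ‖deriv γ t‖ ≤ M) ∧ ∃ R, ∀ t, |t| ≤ |(γ t).im| + R := by
  set X : Set ℂ := {p | ∃ n : ℕ, p = -a - n} ∪ {p | ∃ n : ℕ, p = -b - n} with hX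
  set Y : Set ℂ := {p | ∃ n : ℕ, p = e + n} ∪ {p | ∃ n : ℕ, p = d + n} with hY
  -- With this `B` every left-hand pole has real part below B and every right-hand pole real part
  -- above -B. So `g` must swing to B at the heights of the former and to -B at those of the latter.
  -- Poles with |re| ≥ B + 1 are on the correct side whatever `g` does.
  set B : ℝ := |a.re| + |b.re| + |e.re| + |d.re| + 1 with hB
  have h0a := abs_nonneg a.re
  have h0b := abs_nonneg b.re
  have h0e := abs_nonneg e.re
  have h0d := abs_nonneg d.re
  have hB0 : 0 ≤ B := by positivity
  have hXY : Disjoint X Y := by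
    refine Set.disjoint_left.2 ?_
    rintro p (⟨n, rfl⟩ | ⟨n, rfl⟩) (⟨m, h⟩ | ⟨m, h⟩)
    · exact hae (n + m) (by push_cast; linear_combination -h)
    · exact had (n + m) (by push_cast; linear_combination -h)
    · exact hbe (n + m) (by push_cast; linear_combination -h)
    · exact hbd (n + m) (by push_cast; linear_combination -h)
  have hXre : ∀ p ∈ X, p.re < B := by
    rintro p (⟨n, rfl⟩ | ⟨n, rfl⟩)
    · have hn : (0 : ℝ) ≤ n := n.cast_nonneg
      have := neg_abs_le a.re
      simp only [Complex.sub_re, Complex.neg_re, Complex.natCast_re]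
      linarith
    · have hn : (0 : ℝ) ≤ n := n.cast_nonneg
      have := neg_abs_le b.re
      simp only [Complex.sub_re, Complex.neg_re, Complex.natCast_re]
      linarith
  have hYre : ∀ p ∈ Y, -B < p.re := by
    rintro p (⟨n, rfl⟩ | ⟨n, rfl⟩)
    · have hn : (0 : ℝ) ≤ n := n.cast_nonneg
      have := neg_abs_le e.re
      simp only [Complex.add_re, Complex.natCast_re]
      linarith
    · have hn : (0 : ℝ) ≤ n := n.cast_nonneg
      have := neg_abs_le d.re
      simp only [Complex.add_re, Complex.natCast_re]
      linarith
  have hP : {p | p ∈ X ∧ |p.re| < B + 1}.Finite := by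
    refine ((finite_setOf_abs_re_add_mul_lt (-a) (-1) (by simp) (B + 1)).union
      (finite_setOf_abs_re_add_mul_lt (-b) (-1) (by simp) (B + 1))).subset ?_
    rintro p ⟨⟨n, rfl⟩ | ⟨n, rfl⟩, hp⟩
    · exact Or.inl ⟨⟨n, by push_cast; ring⟩, hp⟩
    · exact Or.inr ⟨⟨n, by push_cast; ring⟩, hp⟩
  have hQ : {p | p ∈ Y ∧ |p.re| < B + 1}.Finite := by
    refine ((finite_setOf_abs_re_add_mul_lt e 1 (by simp) (B + 1)).union
      (finite_setOf_abs_re_add_mul_lt d 1 (by simp) (B + 1))).subset ?_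
    rintro p ⟨⟨n, rfl⟩ | ⟨n, rfl⟩, hp⟩
    · exact Or.inl ⟨⟨n, by push_cast; ring⟩, hp⟩
    · exact Or.inr ⟨⟨n, by push_cast; ring⟩, hp⟩
  obtain ⟨ε, hε⟩ := exists_shear_separating hP hQ
    (hXY.mono (fun p hp => hp.1) (fun p hp => hp.1))
  obtain ⟨g, hg, hgB, hgS, hgT, M, hM⟩ := exists_contDiff_eq_on_finite
    (hP.image fun p : ℂ => p.im + ε * p.re) (hQ.image fun p : ℂ => p.im + ε * p.re)
    (Set.disjoint_left.2 (by
      rintro _ ⟨p, hp, rfl⟩ ⟨q, hq, h⟩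
      exact hε p hp q hq h.symm)) hB0
  have hleft : ∀ p ∈ X, LiesLeft (shearedGraph g ε) p := fun p hp => by
    refine shearedGraph.liesLeft hgB ?_
    have h1 := hXre p hp
    by_cases h : |p.re| < B + 1
    · rw [hgS _ ⟨p, ⟨hp, h⟩, rfl⟩]; exact h1
    · have h2 := (abs_le.1 (hgB (p.im + ε * p.re))).1
      rcases le_abs.1 (not_lt.1 h) with h | h <;> linarith
  have hright : ∀ p ∈ Y, LiesRight (shearedGraph g ε) p := fun p hp => by
    refine shearedGraph.liesRight hgB ?_
    have h1 := hYre p hp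
    by_cases h : |p.re| < B + 1
    · rw [hgT _ ⟨p, ⟨hp, h⟩, rfl⟩]; exact h1
    · have h2 := (abs_le.1 (hgB (p.im + ε * p.re))).2
      rcases le_abs.1 (not_lt.1 h) with h | h <;> linarith
  refine ⟨shearedGraph g ε, shearedGraph.injective,
    ⟨shearedGraph.isVerticalPath hg hgB, fun n => hleft _ (Or.inl ⟨n, rfl⟩),
      fun n => hleft _ (Or.inr ⟨n, rfl⟩), fun n => hright _ (Or.inl ⟨n, rfl⟩),
      fun n => hright _ (Or.inr ⟨n, rfl⟩)⟩, shearedGraph.contDiff hg, ⟨M + (1 + |ε| * M), ?_⟩,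
    ⟨|ε| * B, shearedGraph.abs_le_abs_im_add hgB⟩⟩
  intro t
  have h1 : HasDerivAt g (deriv g t) t := (hg.differentiable one_ne_zero t).hasDerivAt
  have h2 : HasDerivAt (shearedGraph g ε)
      (((deriv g t : ℝ) : ℂ) + ((1 - ε * deriv g t : ℝ) : ℂ) * Complex.I) t := by
    rw [shearedGraph.eq_ofReal_add]
    exact h1.ofReal_comp.add
      (((hasDerivAt_id t).sub (h1.const_mul ε)).ofReal_comp.mul_const Complex.I)
  rw [h2.deriv]
  refine (norm_add_le _ _).trans (add_le_add ?_ ?_)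
  · rw [Complex.norm_real]; exact hM t
  · rw [norm_mul, Complex.norm_I, mul_one, Complex.norm_real, Real.norm_eq_abs]
    refine (abs_sub _ _).trans ?_
    rw [abs_one, abs_mul]
    gcongr
    exact hM t

theorem separatesPoles_mul_I {a b e d : ℂ} (ha : 0 < a.re) (hb : 0 < b.re) (he : 0 < e.re)
    (hd : 0 < d.re) : SeparatesPoles a b e d fun t : ℝ => t * Complex.I := by
  have hγ : (fun t : ℝ => (t : ℂ) * Complex.I) = shearedGraph (fun _ => 0) 0 := by
    rw [shearedGraph.eq_ofReal_add]; simp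
  rw [hγ]
  have h0 : ∀ t : ℝ, |(fun _ : ℝ => (0 : ℝ)) t| ≤ 0 := by simp
  refine ⟨shearedGraph.isVerticalPath contDiff_const h0, fun n => shearedGraph.liesLeft h0 ?_,
    fun n => shearedGraph.liesLeft h0 ?_, fun n => shearedGraph.liesRight h0 ?_,
    fun n => shearedGraph.liesRight h0 ?_⟩ <;>
  · have hn : (0 : ℝ) ≤ n := n.cast_nonneg
    simp
    linarith

/-! ### Barnes' first lemma for every separating path. -/

/-- The value of Barnes' first integral. -/
noncomputable def barnesValue (a b e d : ℂ) : ℂ :=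
  2 * Real.pi * Complex.I * (Complex.Gamma (a + e) * Complex.Gamma (a + d) * Complex.Gamma (b + e) *
    Complex.Gamma (b + d) / Complex.Gamma (a + b + e + d))

theorem barnesKernel_swap_left (a b e d : ℂ) : barnesKernel b a e d = barnesKernel a b e d := by
  ext s; unfold barnesKernel; ring

theorem barnesKernel_swap_right (a b e d : ℂ) : barnesKernel a b d e = barnesKernel a b e d := by
  ext s; unfold barnesKernel; ring

theorem barnesValue_swap_left (a b e d : ℂ) : barnesValue b a e d = barnesValue a b e d := by
  unfold barnesValue; rw [add_comm b a]; ring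

theorem barnesValue_swap_right (a b e d : ℂ) : barnesValue a b d e = barnesValue a b e d := by
  unfold barnesValue; rw [add_right_comm (a + b) d e]; ring

theorem hasContourIntegral_of_integrable {γ : ℝ → ℂ} {f : ℂ → ℂ}
    (h : Integrable fun t => f (γ t) * deriv γ t) :
    HasContourIntegral γ f (∫ t, f (γ t) * deriv γ t) :=
  ⟨fun _ _ => h.intervalIntegrable, intervalIntegral_tendsto_integral h tendsto_fst tendsto_snd⟩

theorem integrable_barnesKernel_mul_I {a b e d : ℂ} (ha : 0 < a.re) (hb : 0 < b.re)
    (he : 0 < e.re) (hd : 0 < d.re) :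
    Integrable fun y : ℝ => barnesKernel a b e d (y * Complex.I) := by
  have hbound : ∀ {c : ℂ}, 0 < c.re → ∃ C, 0 ≤ C ∧ ∀ y : ℝ,
      ‖Complex.Gamma (c + y * Complex.I)‖ ≤ C := fun hc => by
    obtain ⟨C, hC0, hC⟩ := exists_norm_Gamma_add_mul_I_le hc
    refine ⟨C, hC0, fun y => (hC y).trans (mul_le_of_le_one_right hC0 (Real.exp_le_one_iff.2 ?_))⟩
    exact mul_nonpos_of_nonpos_of_nonneg (by linarith [Real.pi_pos]) (abs_nonneg _)
  obtain ⟨C, hC0, hC⟩ := hbound hb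
  obtain ⟨D, hD0, hD⟩ := hbound he
  have hneg : ∀ y : ℝ, e - y * Complex.I = e + ((-y : ℝ) : ℂ) * Complex.I := fun y => by
    push_cast; ring
  have h := (integrable_Gamma_mul_Gamma ha hd).bdd_mul (c := C * D)
    (f := fun y : ℝ => Complex.Gamma (b + y * Complex.I) *
      Complex.Gamma (e + ((-y : ℝ) : ℂ) * Complex.I))
    ((continuous_Gamma_add_mul_I hb).mul
      ((continuous_Gamma_add_mul_I he).comp continuous_neg)).aestronglyMeasurable
    (.of_forall fun y => by
      rw [norm_mul]
      exact mul_le_mul (hC y) (hD (-y)) (norm_nonneg _) hC0)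
  refine h.congr (.of_forall fun y => ?_)
  simp only [← hneg, barnesKernel]
  ring

theorem hasContourIntegral_mul_I_barnesKernel {a b e d : ℂ} (ha : 0 < a.re) (hb : 0 < b.re)
    (he : 0 < e.re) (hd : 0 < d.re) :
    HasContourIntegral (fun t : ℝ => t * Complex.I) (barnesKernel a b e d)
      (barnesValue a b e d) := by
  have hderiv : ∀ t : ℝ, deriv (fun t : ℝ => (t : ℂ) * Complex.I) t = Complex.I := fun t => by
    simpa using ((Complex.ofRealCLM.hasDerivAt (x := t)).mul_const Complex.I).deriv
  have h := hasContourIntegral_of_integrable (γ := fun t : ℝ => t * Complex.I)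
    (f := barnesKernel a b e d) (by
      simp only [hderiv]
      exact (integrable_barnesKernel_mul_I ha hb he hd).mul_const _)
  simp only [hderiv] at h
  rw [integral_mul_const, integral_barnesKernel_mul_I ha hb he hd] at h
  convert h using 1
  unfold barnesValue
  ring

theorem Admissible.add_one {ξ : ℂ} (h : Admissible ξ) : Admissible (ξ + 1) := fun n hn =>
  h (n + 1) (by push_cast; linear_combination hn)

theorem Admissible.ne_zero {ξ : ℂ} (h : Admissible ξ) : ξ ≠ 0 := by simpa using h 0

namespace SeparatesPoles

variable {a b e d : ℂ} {γ : ℝ → ℂ}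

theorem hasContourIntegral_of_raise_left (h : SeparatesPoles a b e d γ) (hae : a + e ≠ 0)
    (had : a + d ≠ 0)
    (hv : HasContourIntegral γ (barnesKernel (a + 1) b e d) (barnesValue (a + 1) b e d)) :
    HasContourIntegral γ (barnesKernel a b e d) (barnesValue a b e d) := by
  obtain ⟨J, hJ, -⟩ := h.exists_hasContourIntegral_barnesKernel h
  have key := h.contiguous_left hJ hv
  have hJv : J = barnesValue a b e d := by
    refine mul_left_cancel₀ (mul_ne_zero hae had) (key.trans ?_)
    unfold barnesValue
    -- The functional equation for 1/Γ holds everywhere, so a + b + e + d may be a pole of Γ; the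
    -- value is then 0.
    have h1 := Complex.one_div_Gamma_eq_self_mul_one_div_Gamma_add_one (a + b + e + d)
    rw [show a + 1 + e = (a + e) + 1 by ring, show a + 1 + d = (a + d) + 1 by ring,
      Complex.Gamma_add_one _ hae, Complex.Gamma_add_one _ had,
      show a + 1 + b + e + d = (a + b + e + d) + 1 by ring, div_eq_mul_inv, div_eq_mul_inv, h1]
    ring
  rwa [← hJv]

theorem hasContourIntegral_of_raise_right (h : SeparatesPoles a b e d γ) (hae : a + e ≠ 0)
    (hbe : b + e ≠ 0)
    (hv : HasContourIntegral γ (barnesKernel a b (e + 1) d) (barnesValue a b (e + 1) d)) :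
    HasContourIntegral γ (barnesKernel a b e d) (barnesValue a b e d) := by
  obtain ⟨J, hJ, -⟩ := h.exists_hasContourIntegral_barnesKernel h
  have key := h.contiguous_right hJ hv
  have hJv : J = barnesValue a b e d := by
    refine mul_left_cancel₀ (mul_ne_zero hae hbe) (key.trans ?_)
    unfold barnesValue
    have h1 := Complex.one_div_Gamma_eq_self_mul_one_div_Gamma_add_one (a + b + e + d)
    rw [show a + (e + 1) = (a + e) + 1 by ring, show b + (e + 1) = (b + e) + 1 by ring,
      Complex.Gamma_add_one _ hae, Complex.Gamma_add_one _ hbe,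
      show a + b + (e + 1) + d = (a + b + e + d) + 1 by ring, div_eq_mul_inv, div_eq_mul_inv, h1]
    ring
  rwa [← hJv]

/-- **Barnes' first lemma** for an arbitrary path separating the poles. -/
theorem hasContourIntegral_barnesKernel (h : SeparatesPoles a b e d γ) (hae : Admissible (a + e))
    (had : Admissible (a + d)) (hbe : Admissible (b + e)) (hbd : Admissible (b + d)) :
    HasContourIntegral γ (barnesKernel a b e d) (barnesValue a b e d) := by
  -- The path stays fixed while all four parameters are raised by 1 at each step, until their real
  -- parts are positive. Then the path may be exchanged for the imaginary axis, and the contiguous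
  -- relations lead back.
  have raise : ∀ N : ℕ, ∀ a b e d : ℂ, SeparatesPoles a b e d γ → Admissible (a + e) →
      Admissible (a + d) → Admissible (b + e) → Admissible (b + d) →
      0 < a.re + N → 0 < b.re + N → 0 < e.re + N → 0 < d.re + N →
      HasContourIntegral γ (barnesKernel a b e d) (barnesValue a b e d) := by
    intro N
    induction N with
    | zero =>
      intro a b e d h _ _ _ _ ha hb he hd
      simp only [Nat.cast_zero, add_zero] at ha hb he hd
      obtain ⟨J, hJ, hJ'⟩ := h.exists_hasContourIntegral_barnesKernel
        (separatesPoles_mul_I ha hb he hd)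
      rwa [← hJ'.unique (hasContourIntegral_mul_I_barnesKernel ha hb he hd)]
    | succ N ih =>
      intro a b e d h hae had hbe hbd ha hb he hd
      have hae1 : Admissible (a + 1 + e) := by rw [add_right_comm]; exact hae.add_one
      have had1 : Admissible (a + 1 + d) := by rw [add_right_comm]; exact had.add_one
      have hbe1 : Admissible (b + 1 + e) := by rw [add_right_comm]; exact hbe.add_one
      have hbd1 : Admissible (b + 1 + d) := by rw [add_right_comm]; exact hbd.add_one
      have hae2 : Admissible (a + 1 + (e + 1)) := by rw [← add_assoc]; exact hae1.add_one
      have had2 : Admissible (a + 1 + (d + 1)) := by rw [← add_assoc]; exact had1.add_one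
      have hbe2 : Admissible (b + 1 + (e + 1)) := by rw [← add_assoc]; exact hbe1.add_one
      have hbd2 : Admissible (b + 1 + (d + 1)) := by rw [← add_assoc]; exact hbd1.add_one
      have s1 := h.raise_left
      have s2 := s1.swap_left.raise_left.swap_left
      have s3 := s2.raise_right
      have s4 := s3.swap_right.raise_right.swap_right
      push_cast at ha hb he hd
      have v4 := ih _ _ _ _ s4 hae2 had2 hbe2 hbd2
        (by rw [Complex.add_re, Complex.one_re]; linarith)
        (by rw [Complex.add_re, Complex.one_re]; linarith)
        (by rw [Complex.add_re, Complex.one_re]; linarith)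
        (by rw [Complex.add_re, Complex.one_re]; linarith)
      have v3 := s3.swap_right.hasContourIntegral_of_raise_right had1.ne_zero hbd1.ne_zero (by
        rwa [barnesKernel_swap_right, barnesValue_swap_right])
      rw [barnesKernel_swap_right, barnesValue_swap_right] at v3
      have v2 := s2.hasContourIntegral_of_raise_right hae1.ne_zero hbe1.ne_zero v3
      have v1 := s1.swap_left.hasContourIntegral_of_raise_left hbe.ne_zero hbd.ne_zero (by
        rwa [barnesKernel_swap_left, barnesValue_swap_left])
      rw [barnesKernel_swap_left, barnesValue_swap_left] at v1
      exact h.hasContourIntegral_of_raise_left hae.ne_zero had.ne_zero v1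
  obtain ⟨N, hN⟩ := exists_nat_gt (|a.re| + |b.re| + |e.re| + |d.re|)
  have h0a := abs_nonneg a.re
  have h0b := abs_nonneg b.re
  have h0e := abs_nonneg e.re
  have h0d := abs_nonneg d.re
  exact raise N a b e d h hae had hbe hbd (by linarith [neg_abs_le a.re])
    (by linarith [neg_abs_le b.re]) (by linarith [neg_abs_le e.re]) (by linarith [neg_abs_le d.re])

end SeparatesPoles

/-! ### The Barnes integral as an analytic function of z. -/

theorem norm_cpow_le_exp {z : ℂ} (hz : z ≠ 0) (w : ℂ) :
    ‖z ^ w‖ ≤ Real.exp (|Real.log ‖z‖| * |w.re| + Real.pi * |w.im|) := by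
  rw [Complex.norm_cpow_of_ne_zero hz, div_eq_mul_inv, ← Real.exp_neg,
    Real.rpow_def_of_pos (norm_pos_iff.2 hz), ← Real.exp_add]
  refine Real.exp_le_exp.2 (add_le_add ?_ ?_)
  · rw [← abs_mul]; exact le_abs_self _
  · refine (neg_le_abs _).trans ?_
    rw [abs_mul]
    exact mul_le_mul_of_nonneg_right (Complex.abs_arg_le_pi z) (abs_nonneg _)

theorem const_cpow_isBigO_stripEnds {z : ℂ} (hz : z ≠ 0) (B : ℝ) :
    (fun s => z ^ s) =O[stripEnds B] fun s => Real.exp (Real.pi * |s.im|) := by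
  refine Asymptotics.IsBigO.of_bound (Real.exp (|Real.log ‖z‖| * B))
    (eventually_stripEnds.2 ⟨0, fun s hs _ => (norm_cpow_le_exp hz s).trans ?_⟩)
  rw [Real.norm_of_nonneg (Real.exp_pos _).le, ← Real.exp_add]
  refine Real.exp_le_exp.2 ?_
  gcongr

theorem IsVerticalPath.tendsto_stripEnds {γ : ℝ → ℂ} (hγ : IsVerticalPath γ) {B : ℝ}
    (hB : ∀ t, |(γ t).re| < B) : Tendsto γ (cocompact ℝ) (stripEnds B) :=
  tendsto_inf.2 ⟨tendsto_comap_iff.2 hγ.tendsto_abs_im_cocompact,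
    tendsto_principal.2 (.of_forall hB)⟩

theorem SeparatesPoles.continuous_barnesKernel {a b e d : ℂ} {γ : ℝ → ℂ}
    (h : SeparatesPoles a b e d γ) : Continuous fun t => barnesKernel a b e d (γ t) := by
  refine continuous_iff_continuousAt.2 fun t => ?_
  have h1 : ContinuousAt (barnesKernel a b e d) (γ t) :=
    (differentiableAt_barnesKernel (h.const_add_ne t) (h.swap_left.const_add_ne t)
      (h.const_sub_ne t) (h.swap_right.const_sub_ne t)).continuousAt
  exact h1.comp h.vertical.piecewiseC1.1.continuousAt

/-- The decay at the ends of the strip covers all but a compact set of parameters, where continuity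
suffices because the path avoids the poles. -/
theorem SeparatesPoles.exists_norm_barnesKernel_le {a b e d : ℂ} {γ : ℝ → ℂ}
    (h : SeparatesPoles a b e d γ) :
    ∃ C, 0 ≤ C ∧ ∀ t, ‖barnesKernel a b e d (γ t)‖ ≤
      C * Real.exp (-(4 * Real.pi / 3) * |(γ t).im|) := by
  obtain ⟨B, hB⟩ := h.vertical.bounded_re
  have hB' : ∀ t, |(γ t).re| < B + 1 := fun t => (hB t).trans_lt (lt_add_one _)
  obtain ⟨C, hC⟩ := ((barnesKernel_isBigO_stripEnds (B + 1) a b e d).comp_tendsto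
    (h.vertical.tendsto_stripEnds hB')).bound
  obtain ⟨K, hK, hKC⟩ := mem_cocompact.1 hC
  have hcont : Continuous fun t => ‖barnesKernel a b e d (γ t)‖ *
      Real.exp (4 * Real.pi / 3 * |(γ t).im|) :=
    h.continuous_barnesKernel.norm.mul (Real.continuous_exp.comp (continuous_const.mul
      (Complex.continuous_im.comp h.vertical.piecewiseC1.1).abs))
  obtain ⟨D, hD⟩ := hK.exists_bound_of_continuousOn hcont.continuousOn
  refine ⟨max (max C D) 0, le_max_right _ _, fun t => ?_⟩
  by_cases ht : t ∈ K
  · have h1 := (le_abs_self _).trans (hD t ht)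
    have h2 : ‖barnesKernel a b e d (γ t)‖ ≤ D * Real.exp (-(4 * Real.pi / 3) * |(γ t).im|) := by
      rw [neg_mul, Real.exp_neg, ← div_eq_mul_inv, le_div_iff₀ (Real.exp_pos _)]
      exact h1
    refine h2.trans (mul_le_mul_of_nonneg_right ?_ (Real.exp_pos _).le)
    exact (le_max_right _ _).trans (le_max_left _ _)
  · have h1 : ‖barnesKernel a b e d (γ t)‖ ≤
        C * ‖Real.exp (-(4 * Real.pi / 3) * |(γ t).im|)‖ := hKC ht
    rw [Real.norm_of_nonneg (Real.exp_pos _).le] at h1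
    refine h1.trans (mul_le_mul_of_nonneg_right ?_ (Real.exp_pos _).le)
    exact (le_max_left _ _).trans (le_max_left _ _)

/-- A `C¹` path separating the poles, with bounded speed and imaginary part of linear growth. -/
structure IsTameContour (a b e d : ℂ) (γ : ℝ → ℂ) : Prop where
  separates : SeparatesPoles a b e d γ
  contDiff : ContDiff ℝ 1 γ
  exists_norm_deriv_le : ∃ M, ∀ t, ‖deriv γ t‖ ≤ M
  exists_abs_le : ∃ R, ∀ t, |t| ≤ |(γ t).im| + R

/-- Barnes' integral along a tame path. -/
noncomputable def barnesIntegral (a b e d : ℂ) (γ : ℝ → ℂ) (z : ℂ) : ℂ :=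
  ∫ t, barnesKernel a b e d (γ t) * z ^ (γ t - d) * deriv γ t

namespace IsTameContour

variable {a b e d : ℂ} {γ : ℝ → ℂ}

theorem raise_right (h : IsTameContour a b e d γ) : IsTameContour a b e (d + 1) γ :=
  ⟨h.separates.swap_right.raise_right.swap_right, h.contDiff, h.exists_norm_deriv_le,
    h.exists_abs_le⟩

theorem continuous_integrand (h : IsTameContour a b e d γ) {z : ℂ} (hz : z ≠ 0) :
    Continuous fun t => barnesKernel a b e d (γ t) * z ^ (γ t - d) * deriv γ t :=
  (h.separates.continuous_barnesKernel.mul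
    ((h.contDiff.continuous.sub continuous_const).const_cpow (Or.inl hz))).mul
    (h.contDiff.continuous_deriv le_rfl)

/-- The kernel decays at rate 4π/3 and the power grows at rate at most π, which leaves π/3. Linear
growth of the imaginary part turns this into decay in t, uniformly for |log ‖z‖| ≤ l, as
differentiation under the integral requires. -/
theorem exists_bound (h : IsTameContour a b e d γ) (l : ℝ) :
    ∃ g : ℝ → ℝ, Integrable g ∧ ∀ z : ℂ, z ≠ 0 → |Real.log ‖z‖| ≤ l → ∀ t,
      ‖barnesKernel a b e d (γ t) * z ^ (γ t - d) * deriv γ t‖ ≤ g t := by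
  obtain ⟨C, hC0, hC⟩ := h.separates.exists_norm_barnesKernel_le
  obtain ⟨M, hM⟩ := h.exists_norm_deriv_le
  obtain ⟨R, hR⟩ := h.exists_abs_le
  obtain ⟨B, hB⟩ := h.separates.vertical.bounded_re
  have hM0 : 0 ≤ M := (norm_nonneg _).trans (hM 0)
  refine ⟨fun t => C * M * Real.exp (l * (B + |d.re|) + Real.pi * |d.im| + Real.pi / 3 * R) *
    Real.exp (-(Real.pi / 3) * |t|),
    (integrable_exp_neg_mul_abs (by positivity)).const_mul _, fun z hz hl t => ?_⟩
  have hl0 : 0 ≤ l := (abs_nonneg _).trans hl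
  have hre : |(γ t - d).re| ≤ B + |d.re| := by
    rw [Complex.sub_re]; exact (abs_sub _ _).trans (by linarith [hB t])
  have him : |(γ t - d).im| ≤ |(γ t).im| + |d.im| := by
    rw [Complex.sub_im]; exact abs_sub _ _
  have hz' : ‖z ^ (γ t - d)‖ ≤
      Real.exp (l * (B + |d.re|) + Real.pi * (|(γ t).im| + |d.im|)) := by
    refine (norm_cpow_le_exp hz _).trans (Real.exp_le_exp.2 ?_)
    gcongr
  rw [norm_mul, norm_mul]
  calc _ ≤ C * Real.exp (-(4 * Real.pi / 3) * |(γ t).im|) *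
        Real.exp (l * (B + |d.re|) + Real.pi * (|(γ t).im| + |d.im|)) * M := by
        gcongr
        exacts [hC t, hM t]
    _ = C * M * Real.exp (l * (B + |d.re|) + Real.pi * |d.im| + -(Real.pi / 3) * |(γ t).im|) := by
        rw [mul_assoc C, ← Real.exp_add, mul_right_comm]
        congr 2
        ring
    _ ≤ C * M * Real.exp (l * (B + |d.re|) + Real.pi * |d.im| +
        (Real.pi / 3 * R + -(Real.pi / 3) * |t|)) := by
        gcongr
        have := mul_le_mul_of_nonneg_left (hR t) (by positivity : 0 ≤ Real.pi / 3)
        linarith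
    _ = _ := by
        beta_reduce
        rw [mul_assoc (C * M), ← Real.exp_add, add_assoc _ _ (-(Real.pi / 3) * |t|)]

theorem integrable (h : IsTameContour a b e d γ) {z : ℂ} (hz : z ≠ 0) :
    Integrable fun t => barnesKernel a b e d (γ t) * z ^ (γ t - d) * deriv γ t := by
  obtain ⟨g, hg, hb⟩ := h.exists_bound |Real.log ‖z‖|
  exact hg.mono' (h.continuous_integrand hz).aestronglyMeasurable
    (.of_forall (hb z hz le_rfl))

/-- Differentiating z^(s - d) brings down s - d, which Γ(d - s) absorbs to become -Γ(d + 1 - s). The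
exponent s - d then turns into s - (d + 1), so the family of integrals is closed under
differentiation. -/
theorem hasDerivAt_barnesIntegral (h : IsTameContour a b e d γ) {z : ℂ}
    (hz : z ∈ Complex.slitPlane) :
    HasDerivAt (barnesIntegral a b e d γ) (-barnesIntegral a b e (d + 1) γ z) z := by
  have hz0 := Complex.slitPlane_ne_zero hz
  obtain ⟨g, hg, hb⟩ := h.raise_right.exists_bound (|Real.log ‖z‖| + 1)
  have hlog : ContinuousAt (fun z : ℂ => |Real.log ‖z‖|) z :=
    ((continuous_norm.continuousAt).log (norm_ne_zero_iff.2 hz0)).abs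
  have hnhds : {w : ℂ | w ∈ Complex.slitPlane ∧ |Real.log ‖w‖| < |Real.log ‖z‖| + 1} ∈ 𝓝 z := by
    filter_upwards [Complex.isOpen_slitPlane.mem_nhds hz,
      hlog.eventually_lt_const (lt_add_one _)] with w h1 h2 using ⟨h1, h2⟩
  have key := (hasDerivAt_integral_of_dominated_loc_of_deriv_le (𝕜 := ℂ)
    (F := fun w t => barnesKernel a b e d (γ t) * w ^ (γ t - d) * deriv γ t)
    (F' := fun w t => -(barnesKernel a b e (d + 1) (γ t) * w ^ (γ t - (d + 1)) * deriv γ t))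
    (bound := g) hnhds ?_ (h.integrable hz0) ?_ ?_ hg ?_).2
  · rw [integral_neg] at key
    exact key
  · filter_upwards [Complex.isOpen_slitPlane.mem_nhds hz] with w hw
    exact (h.continuous_integrand (Complex.slitPlane_ne_zero hw)).aestronglyMeasurable
  · exact (h.raise_right.continuous_integrand hz0).neg.aestronglyMeasurable
  · refine .of_forall fun t w hw => ?_
    rw [norm_neg]
    exact hb w (Complex.slitPlane_ne_zero hw.1) hw.2.le t
  · refine .of_forall fun t w hw => ?_
    have h1 : HasDerivAt (fun w : ℂ => w ^ (γ t - d)) ((γ t - d) * w ^ (γ t - d - 1) * 1) w :=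
      (hasDerivAt_id w).cpow_const hw.1
    refine ((h1.const_mul (barnesKernel a b e d (γ t))).mul_const (deriv γ t)).congr_deriv ?_
    have hne := h.separates.swap_right.const_sub_ne t 0
    simp only [Nat.cast_zero, neg_zero] at hne
    unfold barnesKernel
    rw [show d + 1 - γ t = (d - γ t) + 1 by ring, Complex.Gamma_add_one _ hne, sub_sub]
    ring

theorem add_nat (h : IsTameContour a b e d γ) (n : ℕ) : IsTameContour a b e (d + n) γ := by
  induction n with
  | zero => simpa using h
  | succ n ih => simpa [add_assoc] using ih.raise_right

theorem iteratedDeriv_barnesIntegral (h : IsTameContour a b e d γ) (n : ℕ) :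
    ∀ z ∈ Complex.slitPlane, iteratedDeriv n (barnesIntegral a b e d γ) z =
      (-1) ^ n * barnesIntegral a b e (d + n) γ z := by
  induction n with
  | zero => intro z _; simp
  | succ n ih =>
    intro z hz
    have hev : iteratedDeriv n (barnesIntegral a b e d γ) =ᶠ[𝓝 z]
        fun z => (-1) ^ n * barnesIntegral a b e (d + n) γ z := by
      filter_upwards [Complex.isOpen_slitPlane.mem_nhds hz] with w hw using ih w hw
    rw [iteratedDeriv_succ, hev.deriv_eq,
      (((h.add_nat n).hasDerivAt_barnesIntegral hz).const_mul _).deriv, pow_succ, Nat.cast_succ,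
      add_assoc]
    ring

theorem barnesIntegral_one (h : IsTameContour a b e d γ) (hae : Admissible (a + e))
    (had : Admissible (a + d)) (hbe : Admissible (b + e)) (hbd : Admissible (b + d)) :
    barnesIntegral a b e d γ 1 = barnesValue a b e d := by
  have h1 := h.integrable one_ne_zero
  have h2 := h.separates.hasContourIntegral_barnesKernel hae had hbe hbd
  simp only [Complex.one_cpow, mul_one] at h1
  have h3 := (hasContourIntegral_of_integrable h1).unique h2
  simpa [barnesIntegral] using h3

end IsTameContour

/-! ### Identification with the Gauss series and its continuation. -/

theorem Admissible.add_nat {ξ : ℂ} (h : Admissible ξ) (n : ℕ) : Admissible (ξ + n) := fun m hm =>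
  h (m + n) (by push_cast; linear_combination hm)

theorem Admissible.Gamma_ne_zero {ξ : ℂ} (h : Admissible ξ) : Complex.Gamma ξ ≠ 0 :=
  Complex.Gamma_ne_zero h

theorem Admissible.Gamma_add_nat {ξ : ℂ} (h : Admissible ξ) (n : ℕ) :
    Complex.Gamma (ξ + n) = (ascPochhammer ℂ n).eval ξ * Complex.Gamma ξ := by
  rw [← Complex.Gamma_add_nat_div_Gamma_eq ξ h, div_mul_cancel₀ _ h.Gamma_ne_zero]

/-- Taylor expansion at z = 1, whose unit disc lies in the slit plane. The n-th derivative there is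
Barnes' first lemma with d = n, and the quotients Γ(ξ + n)/Γ(ξ) are the Pochhammer symbols of the
Gauss series. -/
theorem IsTameContour.barnesIntegral_one_sub {a b c : ℂ} {γ : ℝ → ℂ}
    (h : IsTameContour a b (c - a - b) 0 γ) (ha : Admissible a) (hca : Admissible (c - a))
    (hb : Admissible b) (hcb : Admissible (c - b)) (hc : Admissible c) {w : ℂ} (hw : ‖w‖ < 1) :
    barnesIntegral a b (c - a - b) 0 γ (1 - w) =
      2 * Real.pi * Complex.I * (Complex.Gamma a * Complex.Gamma (c - a) * Complex.Gamma b *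
        Complex.Gamma (c - b) / Complex.Gamma c) * ordinaryHypergeometric a b c w := by
  have hae : a + (c - a - b) = c - b := by ring
  have hbe : b + (c - a - b) = c - a := by ring
  have hball : ∀ z ∈ Metric.ball (1 : ℂ) 1, z ∈ Complex.slitPlane := fun z hz => by
    have := Complex.mem_slitPlane_of_norm_lt_one (z := z - 1) (by simpa [dist_eq_norm] using hz)
    simpa using this
  have hdiff : DifferentiableOn ℂ (barnesIntegral a b (c - a - b) 0 γ) (Metric.ball 1 1) :=
    fun z hz => (h.hasDerivAt_barnesIntegral (hball z hz)).differentiableAt.differentiableWithinAt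
  have hT := Complex.taylorSeries_eq_on_ball' (z := 1 - w) (by simpa [dist_eq_norm] using hw) hdiff
  rw [← hT, ordinaryHypergeometric_eq_tsum]
  simp only
  rw [← tsum_mul_left]
  refine tsum_congr fun n => ?_
  rw [h.iteratedDeriv_barnesIntegral n 1 Complex.one_mem_slitPlane,
    (h.add_nat n).barnesIntegral_one (by rwa [hae]) (by simpa using ha.add_nat n) (by rwa [hbe])
      (by simpa using hb.add_nat n)]
  unfold barnesValue
  rw [hae, hbe, zero_add, show a + b + (c - a - b) + (n : ℂ) = c + n by ring,
    ha.Gamma_add_nat, hb.Gamma_add_nat, hc.Gamma_add_nat]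
  have hpow : (1 - w - 1) ^ n = (-1) ^ n * w ^ n := by rw [← mul_pow]; congr 1; ring
  -- One sign comes from the n-th derivative, the other from z - 1 = -w.
  have hsign : ((-1 : ℂ) ^ n) * (-1) ^ n = 1 := by rw [← mul_pow]; simp
  rw [hpow, smul_eq_mul]
  simp only [div_eq_mul_inv, mul_inv]
  linear_combination ((n.factorial : ℂ)⁻¹ * (2 * Real.pi * Complex.I *
    (Complex.Gamma (c - b) * ((ascPochhammer ℂ n).eval a * Complex.Gamma a) *
      Complex.Gamma (c - a) * ((ascPochhammer ℂ n).eval b * Complex.Gamma b) *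
      (((ascPochhammer ℂ n).eval c)⁻¹ * (Complex.Gamma c)⁻¹))) * w ^ n) * hsign

/-- Admissibility makes the constant nonzero, so it can be divided out. This also proves that the
continuation exists, which the choice in `gaussF` needs. -/
theorem IsTameContour.isGaussContinuation {a b c : ℂ} {γ : ℝ → ℂ}
    (h : IsTameContour a b (c - a - b) 0 γ) (ha : Admissible a) (hca : Admissible (c - a))
    (hb : Admissible b) (hcb : Admissible (c - b)) (hc : Admissible c) :
    IsGaussContinuation a b c fun w =>
      (2 * Real.pi * Complex.I * (Complex.Gamma a * Complex.Gamma (c - a) * Complex.Gamma b *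
        Complex.Gamma (c - b) / Complex.Gamma c))⁻¹ *
        barnesIntegral a b (c - a - b) 0 γ (1 - w) := by
  refine ⟨fun w hw => ?_, fun w hw => ?_⟩
  · have h1 := (h.hasDerivAt_barnesIntegral hw).differentiableAt
    exact ((h1.comp w (f := fun w => 1 - w) (by fun_prop)).const_mul _).differentiableWithinAt
  · beta_reduce
    rw [h.barnesIntegral_one_sub ha hca hb hcb hc hw, inv_mul_cancel_left₀]
    refine mul_ne_zero Complex.two_pi_I_ne_zero (div_ne_zero ?_ hc.Gamma_ne_zero)
    exact mul_ne_zero (mul_ne_zero (mul_ne_zero ha.Gamma_ne_zero hca.Gamma_ne_zero)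
      hb.Gamma_ne_zero) hcb.Gamma_ne_zero

/-- The analytic continuation of the Gauss series is unique. -/
theorem IsGaussContinuation.eq {a b c : ℂ} {f g : ℂ → ℂ} (hf : IsGaussContinuation a b c f)
    (hg : IsGaussContinuation a b c g) {w : ℂ} (hw : 1 - w ∈ Complex.slitPlane) : f w = g w := by
  have hopen : IsOpen {w : ℂ | 1 - w ∈ Complex.slitPlane} :=
    Complex.isOpen_slitPlane.preimage (continuous_const.sub continuous_id)
  have hpre : IsPreconnected {w : ℂ | 1 - w ∈ Complex.slitPlane} := by
    have himage : {w : ℂ | 1 - w ∈ Complex.slitPlane} =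
        (fun z : ℂ => 1 - z) '' Complex.slitPlane := by
      ext w
      exact ⟨fun h => ⟨1 - w, h, by ring⟩, by rintro ⟨z, hz, rfl⟩; simpa using hz⟩
    rw [himage]
    exact (Complex.starConvex_one_slitPlane.isPathConnected
      Complex.one_mem_slitPlane).isConnected.isPreconnected.image _ (by fun_prop)
  refine (hf.1.analyticOnNhd hopen).eqOn_of_preconnected_of_eventuallyEq
    (hg.1.analyticOnNhd hopen) hpre (z₀ := 0) (by simp) ?_ hw
  filter_upwards [Metric.ball_mem_nhds (0 : ℂ) one_pos] with z hz
  have hz' : ‖z‖ < 1 := by simpa using hz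
  rw [hf.2 z hz', hg.2 z hz']

theorem IsBarnesContour.separatesPoles {a b c : ℂ} {γ : ℝ → ℂ} (h : IsBarnesContour a b c γ) :
    SeparatesPoles a b (c - a - b) 0 γ :=
  ⟨h.vertical, h.left_a, h.left_b, h.right_c, fun n => by simpa using h.right_zero n⟩

theorem mainTheorem1 (a b c z : ℂ) (hz : z ∈ Complex.slitPlane)
    (ha : Admissible a) (hca : Admissible (c - a)) (hb : Admissible b)
    (hcb : Admissible (c - b)) (hc : Admissible c) :
    IsGaussContinuation a b c (gaussF a b c) ∧
    (∃ γ : ℝ → ℂ, Function.Injective γ ∧ IsBarnesContour a b c γ) ∧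
    ∀ γ : ℝ → ℂ, IsBarnesContour a b c γ →
      ∃ J : ℂ,
        HasContourIntegral γ
          (fun s => Complex.Gamma (a + s) * Complex.Gamma (b + s) *
            Complex.Gamma (c - a - b - s) * Complex.Gamma (-s) * z ^ s) J ∧
        Complex.Gamma a * Complex.Gamma (c - a) * Complex.Gamma b * Complex.Gamma (c - b) /
            Complex.Gamma c * gaussF a b c (1 - z) =
          1 / (2 * Real.pi * Complex.I) * J := by
  have hz0 := Complex.slitPlane_ne_zero hz
  -- With e = c - a - b and d = 0, the sums a + e, a + d, b + e, b + d are c - b, a, c - a, b: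
  -- admissibility is the disjointness of left and right poles.
  obtain ⟨γ₀, hinj, hsep, hC1, hspeed, hgrow⟩ := exists_separatesPoles (a := a) (b := b)
    (e := c - a - b) (d := 0) (by rwa [show a + (c - a - b) = c - b by ring]) (by rwa [add_zero])
    (by rwa [show b + (c - a - b) = c - a by ring]) (by rwa [add_zero])
  have htame : IsTameContour a b (c - a - b) 0 γ₀ := ⟨hsep, hC1, hspeed, hgrow⟩
  have hcont := htame.isGaussContinuation ha hca hb hcb hc
  have hF : IsGaussContinuation a b c (gaussF a b c) := Classical.epsilon_spec ⟨_, hcont⟩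
  refine ⟨hF, ⟨γ₀, hinj, ⟨hsep.vertical, hsep.left_a, hsep.left_b, fun n => by
    simpa using hsep.right_d n, hsep.right_e⟩⟩, fun γ hγ => ?_⟩
  -- Path independence with κ = π < 4π/3 transfers the integral from the given path to the tame one.
  obtain ⟨J, hJ, hJ₀⟩ := hγ.separatesPoles.exists_hasContourIntegral hsep (κ := Real.pi)
    (φ := fun s => z ^ s) (fun s => differentiableAt_id.const_cpow (Or.inl hz0))
    (by linarith [Real.pi_pos]) (const_cpow_isBigO_stripEnds hz0)
  refine ⟨J, hJ.congr fun t => by simp [barnesKernel], ?_⟩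
  have hJval : J = barnesIntegral a b (c - a - b) 0 γ₀ z := by
    have h1 := htame.integrable hz0
    simp only [sub_zero] at h1
    have h2 := hJ₀.unique (hasContourIntegral_of_integrable
      (f := fun s => barnesKernel a b (c - a - b) 0 s * z ^ s) h1)
    simpa [barnesIntegral] using h2
  have hval := hF.eq hcont (w := 1 - z) (by simpa using hz)
  rw [hval, hJval, sub_sub_cancel]
  have hA : Complex.Gamma a * Complex.Gamma (c - a) * Complex.Gamma b * Complex.Gamma (c - b) /
      Complex.Gamma c ≠ 0 :=
    div_ne_zero (mul_ne_zero (mul_ne_zero (mul_ne_zero ha.Gamma_ne_zero hca.Gamma_ne_zero)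
      hb.Gamma_ne_zero) hcb.Gamma_ne_zero) hc.Gamma_ne_zero
  rw [mul_inv_rev, ← mul_assoc, mul_inv_cancel_left₀ hA, one_div]
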